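/- Let $n_X \ge n_Z \ge 1$ and $m \ge 3$ be integers, and let $S(x,z)$ be a real homogeneous polynomial of degree $m$ on $\mathbb R^{n_X}\times\mathbb R^{n_Z}$ whose mixed Hessian $S''_{xz} = \big(\partial^2 S/\partial x_i\partial z_j\big)_{1\le i\le n_X,\,1\le j\le n_Z}$ satisfies $$\operatorname{rank} S''_{xz}(x,z) = n_Z \quad\text{for all } (x,z)\neq(0,0).$$ Let $a\in C_0^\infty(\mathbb R^{n_X}\times\mathbb R^{n_Z})$ be complex-valued, and for $\lambda>0$ let $$T_\lambda f(x)=\int_{\mathbb R^{n_Z}} e^{i\lambda S(x,z)}\,a(x,z)\,f(z)\,dz,\qquad x\in\mathbb R^{n_X}.$$ Then $T_\lambda$ defines a bounded linear operator from $L^2(\mathbb R^{n_Z})$ to $L^2(\mathbb R^{n_X})$, and there is a constant $C>0$, independent of $\lambda$ (it may depend on $n_X,n_Z,m,S,a$), such that for all $\lambda\ge 2$ its operator norm satisfies $$\|T_\lambda\|\le\begin{cases} C\,\lambda^{-(n_X+n_Z)/(2m)} & \text{if } m>(n_X+n_Z)/n_Z,\\ C\,\lambda^{-n_Z/2}\log\lambda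 & \text{if } m=(n_X+n_Z)/n_Z,\\ C\,\lambda^{-n_Z/2} & \text{if } m<(n_X+n_Z)/n_Z.\end{cases}$$ -/

import Mathlib

open MeasureTheory
open scoped ContDiff

noncomputable section

/-- The value at `(x, z)` of a real polynomial in the variables `x_i`, `z_j`. -/
def phaseEval {nX nZ : ℕ} (S : MvPolynomial (Fin nX ⊕ Fin nZ) ℝ)
    (x : Fin nX → ℝ) (z : Fin nZ → ℝ) : ℝ :=
  MvPolynomial.eval (Sum.elim x z) S

/-- The mixed Hessian `S''_{xz}(x, z)`, an `nX × nZ` matrix whose `(i, j)` entry is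
`∂² S / ∂x_i ∂z_j` at `(x, z)`. -/
def mixedHessian {nX nZ : ℕ} (S : MvPolynomial (Fin nX ⊕ Fin nZ) ℝ)
    (x : Fin nX → ℝ) (z : Fin nZ → ℝ) : Matrix (Fin nX) (Fin nZ) ℝ :=
  Matrix.of fun i j =>
    phaseEval (MvPolynomial.pderiv (Sum.inl i) (MvPolynomial.pderiv (Sum.inr j) S)) x z

/-- The oscillatory integral `∫ exp(i lam S(x,z)) a(x,z) f(z) dz` (Lebesgue measure). -/
def oscIntegral {nX nZ : ℕ} (S : MvPolynomial (Fin nX ⊕ Fin nZ) ℝ)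
    (a : (Fin nX → ℝ) × (Fin nZ → ℝ) → ℂ) (lam : ℝ)
    (f : (Fin nZ → ℝ) → ℂ) (x : Fin nX → ℝ) : ℂ :=
  ∫ z, Complex.exp (Complex.I * (lam : ℂ) * (phaseEval S x z : ℂ)) * a (x, z) * f z

end

/-! ## An `L²` estimate for oscillatory integral operators with homogeneous polynomial phases -/

/-! ### Calculus of polynomial phases -/

section Phase

variable {nX nZ : ℕ}

/-! The amplitude is cut dyadically in `u = (x, z)` jointly, into shells `‖u‖ ~ ρ` with `ρ = R 2⁻ʲ`,
`j < J`, and a ball of radius `2R 2⁻ᴶ`.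

On a shell, homogeneity rescales the phase to unit size with parameter `s = λρᵐ`. The rescaled
kernel of `T*T` at `(z, w)` is an integral in `x` with phase `s (S(x,z) - S(x,w))`. Writing `z = w +
tθ` with `‖θ‖ = 1`, the difference is `t Ψ`, and the `x`-gradient of `Ψ` at `t = 0` is `S''_{xz} θ`.
Full column rank makes it nonzero away from the origin, so by compactness it stays bounded below for
small `t`. Nonstationary phase then gives decay `(1 + s‖z - w‖)⁻ᴺ` near the diagonal, uniformly in
`ρ` (`exists_shell_kernel_decay`). Schur's test (`memLp_and_integral_sq_le`), after splitting
`z`-space into finitely many small sets, bounds the shell piece by a constant times `λ^(-nZ/2)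
ρ^((nX + nZ - m nZ)/2)` (`exists_shell_bound`). Without oscillation, size alone bounds the ball
piece by a constant times `ρ^((nX + nZ)/2)` (`exists_ball_bound`).

The two bounds balance when `λρᵐ ~ 1`, so the decomposition stops at `2ᴶ ~ λ^(1/m)`. The shell
bounds form a geometric series of ratio `2^((m nZ - nX - nZ)/2)`. It is dominated by the smallest
scale, is constant in `j`, or converges, according to the sign of `m nZ - nX - nZ`; these are the
three regimes (`exists_sum_bound`). -/

theorem phaseEval_C (c : ℝ) (x : Fin nX → ℝ) (z : Fin nZ → ℝ) :
    phaseEval (MvPolynomial.C c) x z = c := by simp [phaseEval]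

theorem phaseEval_add (p q : MvPolynomial (Fin nX ⊕ Fin nZ) ℝ) (x : Fin nX → ℝ)
    (z : Fin nZ → ℝ) : phaseEval (p + q) x z = phaseEval p x z + phaseEval q x z := by
  simp [phaseEval]

theorem phaseEval_mul (p q : MvPolynomial (Fin nX ⊕ Fin nZ) ℝ) (x : Fin nX → ℝ)
    (z : Fin nZ → ℝ) : phaseEval (p * q) x z = phaseEval p x z * phaseEval q x z := by
  simp [phaseEval]

theorem phaseEval_X_inl (i : Fin nX) (x : Fin nX → ℝ) (z : Fin nZ → ℝ) :
    phaseEval (MvPolynomial.X (Sum.inl i)) x z = x i := by simp [phaseEval]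

theorem phaseEval_X_inr (j : Fin nZ) (x : Fin nX → ℝ) (z : Fin nZ → ℝ) :
    phaseEval (MvPolynomial.X (Sum.inr j)) x z = z j := by simp [phaseEval]

theorem contDiff_phaseEval (S : MvPolynomial (Fin nX ⊕ Fin nZ) ℝ) :
    ContDiff ℝ ∞ fun u : (Fin nX → ℝ) × (Fin nZ → ℝ) => phaseEval S u.1 u.2 := by
  induction S using MvPolynomial.induction_on with
  | C c => simpa only [phaseEval_C] using contDiff_const
  | add p q hp hq => simpa only [phaseEval_add] using hp.add hq
  | mul_X p i hp =>
    simp only [phaseEval_mul]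
    refine hp.mul ?_
    rcases i with i | j
    · simp only [phaseEval_X_inl]; fun_prop
    · simp only [phaseEval_X_inr]; fun_prop

theorem phaseEval_smul {m : ℕ} {S : MvPolynomial (Fin nX ⊕ Fin nZ) ℝ} (hS : S.IsHomogeneous m)
    (r : ℝ) (x : Fin nX → ℝ) (z : Fin nZ → ℝ) :
    phaseEval S (r • x) (r • z) = r ^ m * phaseEval S x z := by
  have h : Sum.elim (r • x) (r • z) = r • Sum.elim x z := by
    ext (i | j) <;> simp
  rw [phaseEval, phaseEval, h, MvPolynomial.eval_eq, MvPolynomial.eval_eq, Finset.mul_sum]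
  refine Finset.sum_congr rfl fun d hd => ?_
  have hdeg : ∑ i ∈ d.support, d i = m := by
    have := hS (MvPolynomial.mem_support_iff.1 hd)
    simpa [Finsupp.weight_apply, Finsupp.sum] using this
  simp only [Pi.smul_apply, smul_eq_mul, mul_pow, Finset.prod_mul_distrib,
    Finset.prod_pow_eq_pow_sum, hdeg]
  ring

theorem hasDerivAt_phaseEval_inl (S : MvPolynomial (Fin nX ⊕ Fin nZ) ℝ) (i : Fin nX)
    (x : Fin nX → ℝ) (z : Fin nZ → ℝ) :
    HasDerivAt (fun s : ℝ => phaseEval S (x + s • Pi.single i 1) z)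
      (phaseEval (MvPolynomial.pderiv (Sum.inl i) S) x z) 0 := by
  induction S using MvPolynomial.induction_on with
  | C c => simpa [phaseEval] using hasDerivAt_const (0 : ℝ) c
  | add p q hp hq => simpa only [phaseEval_add, map_add] using hp.fun_add hq
  | mul_X p k hp =>
    have hk : HasDerivAt (fun s : ℝ =>
        phaseEval (MvPolynomial.X k : MvPolynomial (Fin nX ⊕ Fin nZ) ℝ) (x + s • Pi.single i 1) z)
        (phaseEval (MvPolynomial.pderiv (Sum.inl i) (MvPolynomial.X k)) x z) 0 := by
      rcases k with k | j
      · simp only [phaseEval_X_inl, Pi.add_apply, Pi.smul_apply, smul_eq_mul]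
        have := ((hasDerivAt_id (0 : ℝ)).mul_const ((Pi.single i (1 : ℝ) : Fin nX → ℝ) k)).const_add
          (x k)
        refine this.congr_deriv ?_
        by_cases h : k = i
        · subst h; simp [phaseEval]
        · simp [phaseEval, MvPolynomial.pderiv_X, h]
      · simp only [phaseEval_X_inr]
        refine (hasDerivAt_const (0 : ℝ) (z j)).congr_deriv ?_
        simp [phaseEval, MvPolynomial.pderiv_X]
    simp only [phaseEval_mul]
    refine (hp.mul hk).congr_deriv ?_
    simp [Derivation.leibniz, phaseEval]
    ring

/-- The difference quotient of a polynomial phase in `z`, in polar coordinates `w = z + t θ`.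
The last parameter is a dummy, the scale of the amplitude. -/
theorem exists_smooth_difference_quotient (S : MvPolynomial (Fin nX ⊕ Fin nZ) ℝ) :
    ∃ Ψ : (Fin nX → ℝ) × (Fin nZ → ℝ) × (Fin nZ → ℝ) × ℝ × ℝ → ℝ, ContDiff ℝ ∞ Ψ ∧
      (∀ x z θ t ρ, phaseEval S x (z + t • θ) - phaseEval S x z = t * Ψ (x, z, θ, t, ρ)) ∧
      ∀ x z θ ρ, Ψ (x, z, θ, 0, ρ) =
        ∑ j, θ j * phaseEval (MvPolynomial.pderiv (Sum.inr j) S) x z := by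
  induction S using MvPolynomial.induction_on with
  | C c => exact ⟨fun _ => 0, contDiff_const, by simp [phaseEval], by simp [phaseEval]⟩
  | add p q hp hq =>
    obtain ⟨Ψ, h1, h2, h3⟩ := hp
    obtain ⟨Φ, g1, g2, g3⟩ := hq
    refine ⟨fun y => Ψ y + Φ y, h1.add g1, fun x z θ t ρ => ?_, fun x z θ ρ => ?_⟩
    · rw [mul_add, ← h2, ← g2, phaseEval_add, phaseEval_add]; ring
    · simp only [h3, g3, map_add, phaseEval_add, mul_add, Finset.sum_add_distrib]
  | mul_X p k hp =>
    obtain ⟨Ψ, h1, h2, h3⟩ := hp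
    have hc : ContDiff ℝ ∞ fun y : (Fin nX → ℝ) × (Fin nZ → ℝ) × (Fin nZ → ℝ) × ℝ × ℝ =>
        phaseEval p y.1 y.2.1 :=
      (contDiff_phaseEval p).comp
        (f := fun y : (Fin nX → ℝ) × (Fin nZ → ℝ) × (Fin nZ → ℝ) × ℝ × ℝ => (y.1, y.2.1))
        (by fun_prop)
    rcases k with i | j
    · refine ⟨fun y => Ψ y * y.1 i, h1.mul (by fun_prop), fun x z θ t ρ => ?_, fun x z θ ρ => ?_⟩
      · simp only [phaseEval_mul, phaseEval_X_inl]
        linear_combination x i * h2 x z θ t ρ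
      · simp only [h3, Finset.sum_mul]
        refine Finset.sum_congr rfl fun j _ => ?_
        simp [Derivation.leibniz, phaseEval, MvPolynomial.pderiv_X]
        ring
    -- Product rule for difference quotients: the quotient of `p` is multiplied by the shifted
    -- coordinate, and the quotient `θ j` of the coordinate by the unshifted `p`.
    · refine ⟨fun y => Ψ y * (y.2.1 j + y.2.2.2.1 * y.2.2.1 j) + phaseEval p y.1 y.2.1 * y.2.2.1 j,
        (h1.mul (by fun_prop)).add (hc.mul (by fun_prop)), fun x z θ t ρ => ?_, fun x z θ ρ => ?_⟩
      · simp only [phaseEval_mul, phaseEval_X_inr, Pi.add_apply, Pi.smul_apply, smul_eq_mul]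
        linear_combination (z j + t * θ j) * h2 x z θ t ρ
      · simp only [h3, zero_mul, add_zero]
        have : ∀ l, θ l * phaseEval (MvPolynomial.pderiv (Sum.inr l)
            (p * MvPolynomial.X (Sum.inr j))) x z =
            θ l * phaseEval (MvPolynomial.pderiv (Sum.inr l) p) x z * z j +
              if l = j then phaseEval p x z * θ j else 0 := by
          intro l
          by_cases h : l = j
          · subst h
            simp [Derivation.leibniz, phaseEval]; ring
          · simp [Derivation.leibniz, phaseEval, MvPolynomial.pderiv_X, h, Ne.symm h]
            ring
        simp only [this, Finset.sum_add_distrib, Finset.sum_mul, Finset.sum_ite_eq',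
          Finset.mem_univ, if_true]

/-- At `t = 0` the quotient is the derivative of `S` in `z` along `θ`; differentiating it along
`x_i` produces the mixed second derivatives. This is where the mixed Hessian enters the gradient of
the phase. -/
theorem fderiv_difference_quotient_zero {S : MvPolynomial (Fin nX ⊕ Fin nZ) ℝ}
    {Ψ : (Fin nX → ℝ) × (Fin nZ → ℝ) × (Fin nZ → ℝ) × ℝ × ℝ → ℝ} (hΨ : ContDiff ℝ ∞ Ψ)
    (h0 : ∀ x z θ ρ, Ψ (x, z, θ, 0, ρ) =
        ∑ j, θ j * phaseEval (MvPolynomial.pderiv (Sum.inr j) S) x z)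
    (x : Fin nX → ℝ) (z θ : Fin nZ → ℝ) (ρ : ℝ) (i : Fin nX) :
    fderiv ℝ Ψ (x, z, θ, 0, ρ) (Pi.single i 1, 0) = (mixedHessian S x z).mulVec θ i := by
  have hd : HasFDerivAt Ψ (fderiv ℝ Ψ (x, z, θ, 0, ρ))
      ((x, z, θ, (0 : ℝ), ρ) + (0 : ℝ) • ((Pi.single i 1, 0) :
        (Fin nX → ℝ) × (Fin nZ → ℝ) × (Fin nZ → ℝ) × ℝ × ℝ)) := by
    simpa using (hΨ.differentiable (by simp) (x, z, θ, 0, ρ)).hasFDerivAt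
  have hl : HasDerivAt (fun s : ℝ => (x, z, θ, (0 : ℝ), ρ) + s • ((Pi.single i 1, 0) :
      (Fin nX → ℝ) × (Fin nZ → ℝ) × (Fin nZ → ℝ) × ℝ × ℝ)) (Pi.single i 1, 0) 0 := by
    simpa using ((hasDerivAt_id (0 : ℝ)).smul_const ((Pi.single i 1, 0) :
      (Fin nX → ℝ) × (Fin nZ → ℝ) × (Fin nZ → ℝ) × ℝ × ℝ)).const_add (x, z, θ, (0 : ℝ), ρ)
  have h1 := hd.comp_hasDerivAt (0 : ℝ) hl
  have h2 : HasDerivAt (fun s : ℝ => ∑ j, θ j *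
      phaseEval (MvPolynomial.pderiv (Sum.inr j) S) (x + s • Pi.single i 1) z)
      (∑ j, θ j * phaseEval (MvPolynomial.pderiv (Sum.inl i)
        (MvPolynomial.pderiv (Sum.inr j) S)) x z) 0 :=
    HasDerivAt.fun_sum fun j _ => (hasDerivAt_phaseEval_inl _ i x z).const_mul _
  have h3 : (Ψ ∘ fun s : ℝ => (x, z, θ, (0 : ℝ), ρ) + s • ((Pi.single i 1, 0) :
      (Fin nX → ℝ) × (Fin nZ → ℝ) × (Fin nZ → ℝ) × ℝ × ℝ)) = fun s : ℝ => ∑ j, θ j *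
      phaseEval (MvPolynomial.pderiv (Sum.inr j) S) (x + s • Pi.single i 1) z := by
    ext s
    simp [h0]
  rw [h3] at h1
  rw [h1.unique h2]
  simp [Matrix.mulVec, dotProduct, mixedHessian, mul_comm]

/-- The rank equals the number of columns, so rank-nullity leaves no kernel. -/
theorem mixedHessian_mulVec_ne_zero {S : MvPolynomial (Fin nX ⊕ Fin nZ) ℝ} {x : Fin nX → ℝ}
    {z : Fin nZ → ℝ} (h : (mixedHessian S x z).rank = nZ) {θ : Fin nZ → ℝ} (hθ : θ ≠ 0) :
    (mixedHessian S x z).mulVec θ ≠ 0 := by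
  have hinj : LinearMap.ker (mixedHessian S x z).mulVecLin = ⊥ := by
    have h1 := (mixedHessian S x z).mulVecLin.finrank_range_add_finrank_ker
    rw [Matrix.rank] at h
    rw [h, Module.finrank_fin_fun] at h1
    exact Submodule.finrank_eq_zero.1 (by omega)
  intro h0
  exact hθ (LinearMap.ker_eq_bot'.1 hinj θ h0)

end Phase

/-! ### Nonstationary phase with parameters -/

section NonstationaryPhase

variable {E P : Type*} [NormedAddCommGroup E] [NormedSpace ℝ E] [FiniteDimensional ℝ E]
  [MeasurableSpace E] [BorelSpace E] [NormedAddCommGroup P] [NormedSpace ℝ P]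

theorem integral_fderiv_apply_eq_zero (μ : Measure E) [μ.IsAddHaarMeasure] {f : E → ℂ}
    (hf : ContDiff ℝ ∞ f) (hc : HasCompactSupport f) (v : E) : ∫ x, fderiv ℝ f x v ∂μ = 0 := by
  have hfi : Integrable (fun x => fderiv ℝ f x v) μ :=
    ((hf.continuous_fderiv (by simp)).clm_apply
      continuous_const).integrable_of_hasCompactSupport (hc.fderiv_apply ℝ v)
  have := integral_mul_fderiv_eq_neg_fderiv_mul_of_integrable (μ := μ) (𝕜 := ℂ)
    (f := fun _ => 1) (g := f) (v := v) (by simp) (by simpa using hfi)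
    (by simpa using hf.continuous.integrable_of_hasCompactSupport hc)
    (fun x _ => differentiableAt_const _) (fun x _ => hf.differentiable (by simp) x)
  simpa using this

/-- Integration by parts against `exp(isΨ)`. Here `q = (x, p)`, with `p` a parameter. -/
theorem nonstationary_phase_decay (μ : Measure E) [μ.IsAddHaarMeasure] {ι : Type*} [Fintype ι]
    (e : ι → E) {Ψ : E × P → ℝ} (hΨ : ContDiff ℝ ∞ Ψ) {v : ι → E × P → ℝ}
    (hv : ∀ i, ContDiff ℝ ∞ (v i)) {A : Set (E × P)} (hA : IsClosed A) {R : ℝ}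
    (hR : ∀ q ∈ A, ‖q.1‖ ≤ R) {K : Set P} (hK : IsCompact K)
    (hAK : ∀ q ∈ A, q.2 ∈ K → ∑ i, v i q * fderiv ℝ Ψ q (e i, 0) = 1) (N : ℕ) :
    ∀ b : E × P → ℂ, ContDiff ℝ ∞ b → (∀ q ∉ A, b q = 0) →
      ∃ C : ℝ, 0 ≤ C ∧ ∀ p ∈ K, ∀ s : ℝ, 0 ≤ s →
        s ^ N * ‖∫ x, Complex.exp (Complex.I * s * Ψ (x, p)) * b (x, p) ∂μ‖ ≤ C := by
  have hball : IsCompact (Metric.closedBall (0 : E) R) := isCompact_closedBall _ _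
  have hsupp : ∀ b : E × P → ℂ, (∀ q ∉ A, b q = 0) → ∀ p x, x ∉ Metric.closedBall (0 : E) R →
      b (x, p) = 0 := fun b hb p x hx => hb _ fun h => hx (by simpa using hR _ h)
  have hexp : ∀ (s : ℝ) x, ‖Complex.exp (Complex.I * s * (x : ℝ))‖ = 1 := by
    intro s x
    rw [mul_assoc, mul_comm, ← Complex.ofReal_mul, Complex.norm_exp_ofReal_mul_I]
  induction N with
  | zero =>
    intro b hb hbA
    obtain ⟨M, hM⟩ := (hball.prod hK).exists_bound_of_continuousOn hb.continuous.continuousOn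
    refine ⟨|M| * μ.real (Metric.closedBall (0 : E) R), by positivity, fun p hp s _ => ?_⟩
    rw [pow_zero, one_mul]
    have : ∫ x, Complex.exp (Complex.I * s * Ψ (x, p)) * b (x, p) ∂μ =
        ∫ x in Metric.closedBall (0 : E) R, Complex.exp (Complex.I * s * Ψ (x, p)) * b (x, p) ∂μ :=
      (setIntegral_eq_integral_of_forall_compl_eq_zero fun x hx => by
        rw [hsupp b hbA p x hx, mul_zero]).symm
    rw [this]
    refine norm_setIntegral_le_of_norm_le_const hball.measure_lt_top fun x hx => ?_
    rw [norm_mul, hexp, one_mul]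
    exact (hM (x, p) ⟨hx, hp⟩).trans (le_abs_self M)
  | succ N ih =>
    intro b hb hbA
    -- With `G = exp(isΨ)`, the divergence `∑ ∂ᵢ(G vᵢ b)` equals `is G b + G b'`, because `∑ vᵢ ∂ᵢΨ
    -- = 1` wherever `b` can be nonzero. It integrates to zero, so one factor `s` is traded for the
    -- amplitude `b'`. The latter depends on neither `s` nor a choice of `p` and again vanishes off
    -- `A`, so the induction keeps constants uniform.
    let F : ι → E × P → ℂ := fun i q => ((v i q : ℝ) : ℂ) * b q
    have hF : ∀ i, ContDiff ℝ ∞ (F i) := fun i => (Complex.ofRealCLM.contDiff.comp (hv i)).mul hb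
    let b' : E × P → ℂ := fun q => ∑ i, fderiv ℝ (F i) q (e i, 0)
    have hb' : ContDiff ℝ ∞ b' := ContDiff.sum fun i _ =>
      ((hF i).fderiv_right (m := ∞) (by simp)).clm_apply contDiff_const
    have hb'A : ∀ q ∉ A, b' q = 0 := by
      intro q hq
      refine Finset.sum_eq_zero fun i _ => ?_
      have : F i =ᶠ[nhds q] fun _ => 0 := by
        filter_upwards [hA.isOpen_compl.mem_nhds hq] with y hy
        simp [F, hbA y hy]
      simp [this.fderiv_eq]
    obtain ⟨C, hC, hCb⟩ := ih b' hb' hb'A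
    refine ⟨C, hC, fun p hp s hs => ?_⟩
    let G : E → ℂ := fun x => Complex.exp (Complex.I * s * Ψ (x, p))
    have hsl : ∀ x, HasFDerivAt (fun x : E => (x, p)) (ContinuousLinearMap.inl ℝ E P) x :=
      fun x => hasFDerivAt_prodMk_left x p
    have hι : ContDiff ℝ ∞ (fun x : E => (x, p)) := contDiff_id.prodMk contDiff_const
    have hG : ContDiff ℝ ∞ G :=
      (contDiff_const.mul (Complex.ofRealCLM.contDiff.comp (hΨ.comp hι))).cexp
    have hGd : ∀ x w, fderiv ℝ G x w =
        G x * (Complex.I * s * (fderiv ℝ Ψ (x, p) (w, 0) : ℝ)) := by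
      intro x w
      have h1 : HasFDerivAt (fun x => Ψ (x, p))
          ((fderiv ℝ Ψ (x, p)).comp (ContinuousLinearMap.inl ℝ E P)) x :=
        (hΨ.differentiable (by simp) (x, p)).hasFDerivAt.comp x (hsl x)
      have h2 := ((Complex.ofRealCLM.hasFDerivAt.comp x h1).const_mul
        (Complex.I * (s : ℂ))).cexp
      have h3 : fderiv ℝ G x = _ := h2.fderiv
      rw [h3]
      simp [G]
    have hFd : ∀ i x, HasFDerivAt (fun x => F i (x, p))
        ((fderiv ℝ (F i) (x, p)).comp (ContinuousLinearMap.inl ℝ E P)) x := fun i x =>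
      HasFDerivAt.comp (g := F i) x ((hF i).differentiable (by simp) (x, p)).hasFDerivAt (hsl x)
    have hcs : ∀ i, HasCompactSupport fun x => G x * F i (x, p) := fun i =>
      HasCompactSupport.intro hball fun x hx => by simp [F, hsupp b hbA p x hx]
    have hzero : ∀ i, ∫ x, fderiv ℝ (fun x => G x * F i (x, p)) x (e i) ∂μ = 0 := fun i =>
      integral_fderiv_apply_eq_zero μ (hG.mul ((hF i).comp hι)) (hcs i) (e i)
    have hint : ∀ i, Integrable (fun x => fderiv ℝ (fun x => G x * F i (x, p)) x (e i)) μ :=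
      fun i => Continuous.integrable_of_hasCompactSupport
        (((hG.mul ((hF i).comp hι)).continuous_fderiv (by simp)).clm_apply continuous_const)
        ((hcs i).fderiv_apply ℝ _)
    have hsum : ∀ x, ∑ i, fderiv ℝ (fun x => G x * F i (x, p)) x (e i) =
        Complex.I * s * (G x * b (x, p)) + G x * b' (x, p) := by
      intro x
      have h1 : ∀ i, fderiv ℝ (fun x => G x * F i (x, p)) x (e i) =
          Complex.I * s * (G x * b (x, p)) * ((v i (x, p) * fderiv ℝ Ψ (x, p) (e i, 0) : ℝ) : ℂ) +
            G x * fderiv ℝ (F i) (x, p) (e i, 0) := by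
        intro i
        have h := ((hG.differentiable (by simp) x).hasFDerivAt.mul (hFd i x)).fderiv
        have h' : fderiv ℝ (fun x => G x * F i (x, p)) x = _ := h
        rw [h']
        simp only [add_apply, smul_apply, smul_eq_mul,
          ContinuousLinearMap.comp_apply, ContinuousLinearMap.inl_apply, hGd, F]
        push_cast
        ring
      simp only [h1, Finset.sum_add_distrib, ← Finset.mul_sum, ← Complex.ofReal_sum, b']
      by_cases hx : (x, p) ∈ A
      · rw [hAK _ hx hp]; simp
      · simp [hbA _ hx]
    have hcont : ∀ c : E × P → ℂ, ContDiff ℝ ∞ c → (∀ q ∉ A, c q = 0) →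
        Integrable (fun x => G x * c (x, p)) μ := fun c hc hcA =>
      (hG.continuous.mul (hc.continuous.comp hι.continuous)).integrable_of_hasCompactSupport
        (HasCompactSupport.intro hball fun x hx => by simp [hsupp c hcA p x hx])
    have key : Complex.I * s * ∫ x, G x * b (x, p) ∂μ = - ∫ x, G x * b' (x, p) ∂μ := by
      have h0 : ∫ x, ∑ i, fderiv ℝ (fun x => G x * F i (x, p)) x (e i) ∂μ = 0 := by
        rw [integral_finsetSum _ fun i _ => hint i]
        exact Finset.sum_eq_zero fun i _ => hzero i
      simp only [hsum] at h0
      rw [integral_add ((hcont b hb hbA).const_mul _) (hcont b' hb' hb'A),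
        integral_const_mul] at h0
      exact eq_neg_of_add_eq_zero_left h0
    have hn := congrArg norm key
    rw [norm_neg, norm_mul, norm_mul, Complex.norm_I, one_mul, Complex.norm_real,
      Real.norm_of_nonneg hs] at hn
    have h2 := hCb p hp s hs
    change s ^ (N + 1) * ‖∫ x, G x * b (x, p) ∂μ‖ ≤ C
    rw [pow_succ, mul_assoc, hn]
    exact h2

/-- The inverse is multiplied by a cutoff that vanishes for `s ≤ c / 2` and is one for `s ≥ c`. It
supplies vector fields that are smooth even where the phase gradient vanishes. -/
theorem exists_smooth_inv {c : ℝ} (hc : 0 < c) :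
    ∃ q : ℝ → ℝ, ContDiff ℝ ∞ q ∧ ∀ s, c ≤ s → q s * s = 1 := by
  refine ⟨fun s => Real.smoothTransition (2 / c * s - 1) / s, ?_, fun s hs => ?_⟩
  · rw [contDiff_iff_contDiffAt]
    intro s
    by_cases h : 0 < s
    · exact ContDiffAt.div
        (Real.smoothTransition.contDiff.contDiffAt.comp s (by fun_prop)) contDiffAt_id h.ne'
    · have : (fun s => Real.smoothTransition (2 / c * s - 1) / s) =ᶠ[nhds s] fun _ => 0 := by
        filter_upwards [eventually_lt_nhds (show s < c / 2 by linarith)] with y hy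
        rw [Real.smoothTransition.zero_of_nonpos, zero_div]
        have : 2 / c * y < 2 / c * (c / 2) := by gcongr
        field_simp at this ⊢
        linarith
      exact contDiffAt_const.congr_of_eventuallyEq this
  · have : s ≠ 0 := (hc.trans_le hs).ne'
    simp only
    rw [Real.smoothTransition.one_of_one_le, one_div, inv_mul_cancel₀ this]
    have : 2 / c * c ≤ 2 / c * s := by gcongr
    rw [div_mul_cancel₀ _ hc.ne'] at this
    linarith

end NonstationaryPhase

/-! ### An `L²` bound through the kernel of `T*T` -/

theorem HasCompactSupport.exists_radius {G H : Type*} [NormedAddCommGroup G] [Zero H] {k : G → H}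
    (hk : HasCompactSupport k) : ∃ R : ℝ, ∀ u, R < ‖u‖ → k u = 0 := by
  obtain ⟨R, hR⟩ := hk.isCompact.isBounded.subset_closedBall (0 : G)
  refine ⟨R, fun u hu => image_eq_zero_of_notMem_tsupport fun h => ?_⟩
  have := hR h
  rw [mem_closedBall_zero_iff] at this
  linarith

theorem aestronglyMeasurable_kernel_mul {E F : Type*} [NormedAddCommGroup E]
    [SecondCountableTopology E] [MeasurableSpace E] [BorelSpace E] [NormedAddCommGroup F]
    [SecondCountableTopology F] [MeasurableSpace F] [BorelSpace F] {μ : Measure E} {ν : Measure F}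
    [SFinite ν] {k : E × F → ℂ} (hk : Continuous k) {f : F → ℂ}
    (hf : AEStronglyMeasurable f ν) :
    AEStronglyMeasurable (fun x => ∫ z, k (x, z) * f z ∂ν) μ :=
  AEStronglyMeasurable.integral_prod_right' (f := fun u : E × F => k u * f u.2)
    (hk.aestronglyMeasurable.mul hf.comp_snd)

theorem integrable_kernel_mul {E F : Type*} [NormedAddCommGroup E] [NormedAddCommGroup F]
    [ProperSpace F] [MeasurableSpace F] [BorelSpace F] {ν : Measure F}
    [IsFiniteMeasureOnCompacts ν] {k : E × F → ℂ} (hk : Continuous k) (hkc : HasCompactSupport k)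
    {f : F → ℂ} (hf : MemLp f 2 ν) (x : E) : Integrable (fun z => k (x, z) * f z) ν := by
  obtain ⟨R, hR⟩ := hkc.exists_radius
  have h1 : MemLp (fun z => k (x, z)) 2 ν :=
    Continuous.memLp_of_hasCompactSupport (by fun_prop)
      (HasCompactSupport.intro (isCompact_closedBall (0 : F) R) fun z hz => hR _ (by
        rw [mem_closedBall_zero_iff, not_le] at hz
        exact hz.trans_le (le_max_right _ _)))
  exact h1.integrable_mul hf

section Schur

variable {E F : Type*} [NormedAddCommGroup E] [NormedSpace ℝ E] [FiniteDimensional ℝ E]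
  [MeasurableSpace E] [BorelSpace E] [NormedAddCommGroup F] [NormedSpace ℝ F]
  [FiniteDimensional ℝ F] [MeasurableSpace F] [BorelSpace F]
  {μ : Measure E} [μ.IsAddHaarMeasure] {ν : Measure F} [ν.IsAddHaarMeasure]

/-- Schur's test for `T*T`: if the kernel of `T*T` is bounded by a convolution kernel `g`, then
`T` is bounded on `L²` by the square root of the integral of `g`. -/
theorem memLp_and_integral_sq_le {k : E × F → ℂ} (hk : Continuous k) (hkc : HasCompactSupport k)
    {f : F → ℂ} (hf : MemLp f 2 ν) {g : F → ℝ} (hg : Integrable g ν) (hg0 : ∀ z, 0 ≤ g z)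
    (hkg : ∀ z w, f z ≠ 0 → f w ≠ 0 →
      ‖∫ x, k (x, z) * starRingEnd ℂ (k (x, w)) ∂μ‖ ≤ g (z - w)) :
    MemLp (fun x => ∫ z, k (x, z) * f z ∂ν) 2 μ ∧
      ∫ x, ‖∫ z, k (x, z) * f z ∂ν‖ ^ 2 ∂μ ≤ (∫ z, g z ∂ν) * ∫ z, ‖f z‖ ^ 2 ∂ν := by
  obtain ⟨R, hR⟩ := hkc.exists_radius
  obtain ⟨M, hM⟩ := hkc.exists_bound_of_continuous hk
  have hM0 : 0 ≤ M := (norm_nonneg _).trans (hM 0)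
  -- `H(x, ·)` is the integrand of `|Tf(x)|²` as a double integral. Integrating in `x` first brings
  -- out the kernel of `T*T`.
  set H : E × F × F → ℂ := fun y =>
    (k (y.1, y.2.1) * f y.2.1) * starRingEnd ℂ (k (y.1, y.2.2) * f y.2.2) with hH
  have hfm := hf.aestronglyMeasurable
  have hHm : AEStronglyMeasurable H (μ.prod (ν.prod ν)) := by
    refine AEStronglyMeasurable.mul ?_ ?_
    · exact (Continuous.aestronglyMeasurable (by fun_prop)).mul (hfm.comp_fst.comp_snd)
    · refine Complex.continuous_conj.comp_aestronglyMeasurable ?_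
      exact (Continuous.aestronglyMeasurable (by fun_prop)).mul (hfm.comp_snd.comp_snd)
  have hfi : IntegrableOn f (Metric.closedBall 0 R) ν := by
    have : IsFiniteMeasure (ν.restrict (Metric.closedBall 0 R)) :=
      ⟨by simpa using (isCompact_closedBall (0 : F) R).measure_lt_top⟩
    exact (hf.restrict _).integrable (by norm_num)
  have hfi' : Integrable ((Metric.closedBall 0 R).indicator fun z => ‖f z‖) ν :=
    (integrable_indicator_iff Metric.isClosed_closedBall.measurableSet).2 hfi.norm
  have h1i : Integrable ((Metric.closedBall (0 : E) R).indicator fun _ => M ^ 2) μ :=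
    (integrable_indicator_iff Metric.isClosed_closedBall.measurableSet).2
      (integrableOn_const (isCompact_closedBall (0 : E) R).measure_lt_top.ne)
  -- The kernel is bounded with support in a ball, and an `L²` function is integrable on balls; a
  -- product of three integrable functions dominates `H`.
  have hHi : Integrable H (μ.prod (ν.prod ν)) := by
    refine (h1i.mul_prod (hfi'.mul_prod hfi')).mono' hHm (Filter.Eventually.of_forall ?_)
    rintro ⟨x, z, w⟩
    by_cases hx : ‖x‖ ≤ R
    swap
    · have : k (x, z) = 0 := hR _ ((not_le.1 hx).trans_le (le_max_left _ _))
      simp only [hH, this, zero_mul, norm_zero]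
      exact mul_nonneg (Set.indicator_nonneg (fun _ _ => by positivity) _)
        (mul_nonneg (Set.indicator_nonneg (fun _ _ => by positivity) _)
          (Set.indicator_nonneg (fun _ _ => by positivity) _))
    by_cases hz : ‖z‖ ≤ R
    swap
    · have : k (x, z) = 0 := hR _ ((not_le.1 hz).trans_le (le_max_right _ _))
      simp only [hH, this, zero_mul, norm_zero]
      exact mul_nonneg (Set.indicator_nonneg (fun _ _ => by positivity) _)
        (mul_nonneg (Set.indicator_nonneg (fun _ _ => by positivity) _)
          (Set.indicator_nonneg (fun _ _ => by positivity) _))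
    by_cases hw : ‖w‖ ≤ R
    swap
    · have : k (x, w) = 0 := hR _ ((not_le.1 hw).trans_le (le_max_right _ _))
      simp only [hH, this, zero_mul, map_zero, mul_zero, norm_zero]
      exact mul_nonneg (Set.indicator_nonneg (fun _ _ => by positivity) _)
        (mul_nonneg (Set.indicator_nonneg (fun _ _ => by positivity) _)
          (Set.indicator_nonneg (fun _ _ => by positivity) _))
    rw [Set.indicator_of_mem (by simpa using hx), Set.indicator_of_mem (by simpa using hz),
      Set.indicator_of_mem (by simpa using hw)]
    simp only [hH, norm_mul, RCLike.norm_conj]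
    calc ‖k (x, z)‖ * ‖f z‖ * (‖k (x, w)‖ * ‖f w‖) ≤ M * ‖f z‖ * (M * ‖f w‖) := by
          gcongr <;> exact hM _
      _ = M ^ 2 * (‖f z‖ * ‖f w‖) := by ring
  have hsq : ∀ x, ((‖∫ z, k (x, z) * f z ∂ν‖ ^ 2 : ℝ) : ℂ) = ∫ y, H (x, y) ∂(ν.prod ν) := by
    intro x
    have h := integral_prod_mul (μ := ν) (ν := ν) (fun z => k (x, z) * f z)
      (fun w => starRingEnd ℂ (k (x, w) * f w))
    simp only [hH]
    rw [h, integral_conj, Complex.mul_conj, Complex.normSq_eq_norm_sq]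
  have hTm : AEStronglyMeasurable (fun x => ∫ z, k (x, z) * f z ∂ν) μ :=
    aestronglyMeasurable_kernel_mul hk hfm
  have hsqi : Integrable (fun x => ((‖∫ z, k (x, z) * f z ∂ν‖ ^ 2 : ℝ) : ℂ)) μ := by
    simp only [hsq]
    exact hHi.integral_prod_left
  refine ⟨(memLp_two_iff_integrable_sq_norm hTm).2 (hsqi.re), ?_⟩
  have hswap : ((∫ x, ‖∫ z, k (x, z) * f z ∂ν‖ ^ 2 ∂μ : ℝ) : ℂ) =
      ∫ y, ∫ x, H (x, y) ∂μ ∂(ν.prod ν) := by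
    rw [← integral_complex_ofReal]
    simp only [hsq]
    exact integral_integral_swap (f := fun x y => H (x, y)) hHi
  have hf2 : Integrable (fun z => ‖f z‖ ^ 2) ν := (memLp_two_iff_integrable_sq_norm hfm).1 hf
  have hb1 : Integrable (fun y : F × F => ‖f y.2‖ ^ 2 * g (y.1 - y.2)) (ν.prod ν) :=
    hf2.convolution_integrand (ContinuousLinearMap.mul ℝ ℝ) hg
  -- Exchanging the two variables reverses the sign of `z - w`, so the convolution integrand is
  -- first formed with the reflected `g`.
  have hg' : Integrable (fun z => g (-z)) ν := hg.comp_neg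
  have hb2 : Integrable (fun y : F × F => ‖f y.1‖ ^ 2 * g (y.1 - y.2)) (ν.prod ν) := by
    have := (hf2.convolution_integrand (ContinuousLinearMap.mul ℝ ℝ) hg').swap
    simpa [Function.comp_def] using this
  have hi1 : ∫ y : F × F, ‖f y.2‖ ^ 2 * g (y.1 - y.2) ∂(ν.prod ν) =
      (∫ z, g z ∂ν) * ∫ z, ‖f z‖ ^ 2 ∂ν := by
    rw [integral_prod_symm _ hb1]
    simp only [integral_const_mul, integral_sub_right_eq_self, integral_mul_const]
    ring
  have hi2 : ∫ y : F × F, ‖f y.1‖ ^ 2 * g (y.1 - y.2) ∂(ν.prod ν) =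
      (∫ z, g z ∂ν) * ∫ z, ‖f z‖ ^ 2 ∂ν := by
    rw [integral_prod _ hb2]
    simp only [integral_const_mul, integral_sub_left_eq_self, integral_mul_const]
    ring
  -- Since `|f(z)||f(w)|` is at most the mean of the squares, each half integrates to `‖g‖₁ ‖f‖₂²`
  -- by translation invariance.
  have hpt : ∀ y : F × F, ‖∫ x, H (x, y) ∂μ‖ ≤
      (‖f y.2‖ ^ 2 * g (y.1 - y.2) + ‖f y.1‖ ^ 2 * g (y.1 - y.2)) / 2 := by
    rintro ⟨z, w⟩
    have hHe : ∀ x, H (x, z, w) =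
        (k (x, z) * starRingEnd ℂ (k (x, w))) * (f z * starRingEnd ℂ (f w)) := by
      intro x
      simp only [hH, map_mul]
      ring
    simp only [hHe, integral_mul_const, norm_mul, RCLike.norm_conj]
    by_cases hz : f z = 0
    · simp only [hz, norm_zero]
      have := hg0 (z - w)
      nlinarith [mul_nonneg (sq_nonneg ‖f w‖) this]
    by_cases hw : f w = 0
    · simp only [hw, norm_zero]
      have := hg0 (z - w)
      nlinarith [mul_nonneg (sq_nonneg ‖f z‖) this]
    calc _ ≤ g (z - w) * (‖f z‖ * ‖f w‖) := by gcongr; exact hkg z w hz hw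
      _ ≤ g (z - w) * ((‖f w‖ ^ 2 + ‖f z‖ ^ 2) / 2) := by
        refine mul_le_mul_of_nonneg_left ?_ (hg0 _)
        nlinarith [sq_nonneg (‖f z‖ - ‖f w‖)]
      _ = _ := by ring
  have hfin := norm_integral_le_of_norm_le ((hb1.add hb2).div_const 2)
    (Filter.Eventually.of_forall hpt)
  rw [← hswap, Complex.norm_real, integral_div] at hfin
  refine (le_abs_self _).trans (hfin.trans (le_of_eq ?_))
  have : ∫ y : F × F, ((fun y : F × F => ‖f y.2‖ ^ 2 * g (y.1 - y.2)) +
      fun y : F × F => ‖f y.1‖ ^ 2 * g (y.1 - y.2)) y ∂(ν.prod ν) = _ :=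
    integral_add hb1 hb2
  rw [this, hi1, hi2]
  ring

/-- The square root of Schur's test. The kernel bound is needed only where `f` is nonzero, so a
decay estimate valid near the diagonal suffices for `f` of small support. -/
theorem eLpNorm_kernel_le {k : E × F → ℂ} (hk : Continuous k) (hkc : HasCompactSupport k)
    {f : F → ℂ} (hf : MemLp f 2 ν) {g : F → ℝ} (hg : Integrable g ν) (hg0 : ∀ z, 0 ≤ g z)
    (hkg : ∀ z w, f z ≠ 0 → f w ≠ 0 →
      ‖∫ x, k (x, z) * starRingEnd ℂ (k (x, w)) ∂μ‖ ≤ g (z - w)) :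
    eLpNorm (fun x => ∫ z, k (x, z) * f z ∂ν) 2 μ ≤
      ENNReal.ofReal (√(∫ z, g z ∂ν)) * eLpNorm f 2 ν := by
  obtain ⟨h1, h2⟩ := memLp_and_integral_sq_le hk hkc hf hg hg0 hkg
  have hG : 0 ≤ ∫ z, g z ∂ν := integral_nonneg hg0
  rw [h1.eLpNorm_eq_integral_rpow_norm (by norm_num) (by norm_num),
    hf.eLpNorm_eq_integral_rpow_norm (by norm_num) (by norm_num),
    ← ENNReal.ofReal_mul (Real.sqrt_nonneg _)]
  refine ENNReal.ofReal_le_ofReal ?_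
  simp only [ENNReal.toReal_ofNat, Real.rpow_ofNat]
  rw [← one_div, ← Real.sqrt_eq_rpow, ← Real.sqrt_eq_rpow, ← Real.sqrt_mul hG]
  exact Real.sqrt_le_sqrt h2

end Schur

/-! ### Dyadic pieces -/

section Dyadic

variable {nX nZ : ℕ}

/-- The kernel `exp(i lam S(u)) a(u) χ(u / ρ)`, localized at scale `ρ`. -/
noncomputable def scaledKernel (S : MvPolynomial (Fin nX ⊕ Fin nZ) ℝ)
    (a : (Fin nX → ℝ) × (Fin nZ → ℝ) → ℂ) (χ : (Fin nX → ℝ) × (Fin nZ → ℝ) → ℝ) (lam ρ : ℝ)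
    (u : (Fin nX → ℝ) × (Fin nZ → ℝ)) : ℂ :=
  Complex.exp (Complex.I * (lam : ℂ) * (phaseEval S u.1 u.2 : ℂ)) * (a u * χ (ρ⁻¹ • u))

theorem continuous_scaledKernel (S : MvPolynomial (Fin nX ⊕ Fin nZ) ℝ)
    {a : (Fin nX → ℝ) × (Fin nZ → ℝ) → ℂ} (ha : Continuous a)
    {χ : (Fin nX → ℝ) × (Fin nZ → ℝ) → ℝ} (hχ : Continuous χ) (lam ρ : ℝ) :
    Continuous (scaledKernel S a χ lam ρ) := by
  have := (contDiff_phaseEval S).continuous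
  unfold scaledKernel
  fun_prop

theorem hasCompactSupport_scaledKernel (S : MvPolynomial (Fin nX ⊕ Fin nZ) ℝ)
    {a : (Fin nX → ℝ) × (Fin nZ → ℝ) → ℂ} (ha : HasCompactSupport a)
    (χ : (Fin nX → ℝ) × (Fin nZ → ℝ) → ℝ) (lam ρ : ℝ) :
    HasCompactSupport (scaledKernel S a χ lam ρ) :=
  HasCompactSupport.mul_left ha.mul_right

theorem exists_unit_direction (hnZ : 1 ≤ nZ) (z w : Fin nZ → ℝ) :
    ∃ θ : Fin nZ → ℝ, ‖θ‖ = 1 ∧ z = w + ‖z - w‖ • θ := by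
  by_cases h : z = w
  · have : Nonempty (Fin nZ) := ⟨⟨0, hnZ⟩⟩
    exact ⟨fun _ => 1, by simp, by simp [h]⟩
  · have h' : ‖z - w‖ ≠ 0 := norm_ne_zero_iff.2 (sub_ne_zero.2 h)
    refine ⟨‖z - w‖⁻¹ • (z - w), ?_, ?_⟩
    · rw [norm_smul, norm_inv, norm_norm, inv_mul_cancel₀ h']
    · rw [smul_smul, mul_inv_cancel₀ h', one_smul]
      abel

/-- The kernel of `T*T` at unit scale, with rapid decay off the diagonal. -/
theorem exists_shell_kernel_decay (hnZ : 1 ≤ nZ) {S : MvPolynomial (Fin nX ⊕ Fin nZ) ℝ}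
    (hrank : ∀ (x : Fin nX → ℝ) (z : Fin nZ → ℝ), (x, z) ≠ (0, 0) →
      (mixedHessian S x z).rank = nZ)
    {a : (Fin nX → ℝ) × (Fin nZ → ℝ) → ℂ} (ha : ContDiff ℝ ∞ a)
    {χ : (Fin nX → ℝ) × (Fin nZ → ℝ) → ℝ} (hχ : ContDiff ℝ ∞ χ)
    (hχs : ∀ u, χ u ≠ 0 → 1 / 2 ≤ ‖u‖ ∧ ‖u‖ ≤ 2) (R : ℝ) (N : ℕ) :
    ∃ δ : ℝ, 0 < δ ∧ ∃ C : ℝ, 0 ≤ C ∧ ∀ ρ, 0 ≤ ρ → ρ ≤ R → ∀ s : ℝ, 0 ≤ s →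
      ∀ z w : Fin nZ → ℝ, ‖z - w‖ ≤ δ →
        (1 + s * ‖z - w‖) ^ N *
          ‖∫ x, Complex.exp (Complex.I * s * (phaseEval S x z - phaseEval S x w : ℝ)) *
            ((a (ρ • (x, z)) * χ (x, z)) * starRingEnd ℂ (a (ρ • (x, w)) * χ (x, w)))‖ ≤ C := by
  obtain ⟨Ψ, hΨ, hΨd, hΨ0⟩ := exists_smooth_difference_quotient S
  let Q := (Fin nX → ℝ) × (Fin nZ → ℝ) × (Fin nZ → ℝ) × ℝ × ℝ
  let D : Fin nX → Q → ℝ := fun i q => fderiv ℝ Ψ q (Pi.single i 1, 0)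
  have hD : ∀ i, ContDiff ℝ ∞ (D i) := fun i =>
    (hΨ.fderiv_right (m := ∞) (by simp)).clm_apply contDiff_const
  -- `G` is the squared length of the `x`-gradient of `Ψ`; at `t = 0` it is the squared length of
  -- `S''_{xz} θ`.
  let G : Q → ℝ := fun q => ∑ i, D i q ^ 2
  have hG : ContDiff ℝ ∞ G := ContDiff.sum fun i _ => (hD i).pow 2
  have hGpos : ∀ x z θ ρ, (x, z) ≠ (0, 0) → θ ≠ 0 → 0 < G (x, z, θ, 0, ρ) := by
    intro x z θ ρ h0 hθ
    have h1 := mixedHessian_mulVec_ne_zero (hrank x z h0) hθ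
    obtain ⟨i, hi⟩ := Function.ne_iff.1 h1
    refine Finset.sum_pos' (fun i _ => sq_nonneg _) ⟨i, Finset.mem_univ _, ?_⟩
    simp only [D]
    rw [fderiv_difference_quotient_zero hΨ hΨ0]
    exact sq_pos_of_ne_zero hi
  -- The bound `1 / 2 ≤ ‖(x, z)‖` keeps away from the origin, the only point where the rank may
  -- drop. Compactness gives one range of `t` valid for all of `K₀`.
  let K₀ : Set ((Fin nX → ℝ) × (Fin nZ → ℝ) × (Fin nZ → ℝ) × ℝ) :=
    {y | 1 / 2 ≤ ‖(y.1, y.2.1)‖} ∩ (Metric.closedBall 0 2 ×ˢ Metric.closedBall 0 2 ×ˢ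
      Metric.sphere 0 1 ×ˢ Set.Icc 0 R)
  have hK₀ : IsCompact K₀ :=
    ((isCompact_closedBall _ _).prod ((isCompact_closedBall _ _).prod
      ((isCompact_sphere _ _).prod isCompact_Icc))).inter_left
        (isClosed_le continuous_const (by fun_prop))
  have hev : ∀ᶠ t in nhds (0 : ℝ), ∀ y ∈ K₀, 0 < G (y.1, y.2.1, y.2.2.1, t, y.2.2.2) := by
    refine hK₀.eventually_forall_of_forall_eventually fun y hy => ?_
    have hc : Continuous fun r : ℝ × ((Fin nX → ℝ) × (Fin nZ → ℝ) × (Fin nZ → ℝ) × ℝ) =>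
        G (r.2.1, r.2.2.1, r.2.2.2.1, r.1, r.2.2.2.2) :=
      hG.continuous.comp (by fun_prop)
    refine hc.continuousAt.eventually (lt_mem_nhds ?_)
    refine hGpos _ _ _ _ (fun h => ?_) fun h => ?_
    · have := hy.1
      replace h : (y.1, y.2.1) = 0 := h
      simp only [Set.mem_ofPred_eq, h, norm_zero] at this
      norm_num at this
    · have := hy.2.2.2.1
      replace h : y.2.2.1 = 0 := h
      simp [h] at this
  obtain ⟨ε, hε, hεG⟩ := Metric.eventually_nhds_iff.1 hev
  refine ⟨ε / 2, by positivity, ?_⟩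
  -- The parameters are `(w, θ, t, ρ)`. The halved `ε` keeps the closed range of `t` inside the
  -- admissible open one. Including the scale `ρ ∈ [0, R]` in the compact set makes the constants
  -- uniform over all dyadic scales.
  let K : Set ((Fin nZ → ℝ) × (Fin nZ → ℝ) × ℝ × ℝ) :=
    Metric.closedBall 0 2 ×ˢ Metric.sphere 0 1 ×ˢ Set.Icc 0 (ε / 2) ×ˢ Set.Icc 0 R
  have hK : IsCompact K := (isCompact_closedBall _ _).prod
    ((isCompact_sphere _ _).prod (isCompact_Icc.prod isCompact_Icc))
  let A : Set Q := (fun q : Q => ‖(q.1, q.2.1)‖) ⁻¹' Set.Icc (1 / 2) 2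
  have hA : IsClosed A := isClosed_Icc.preimage (by fun_prop)
  have hAR : ∀ q ∈ A, ‖q.1‖ ≤ 2 := fun q hq => (le_max_left _ _).trans hq.2
  have hAK : IsCompact (A ∩ (Metric.closedBall 0 2 ×ˢ K)) :=
    ((isCompact_closedBall _ _).prod hK).inter_left hA
  obtain ⟨c, hc, hcG⟩ := hAK.exists_forall_le' (a := 0) hG.continuous.continuousOn (by
    rintro ⟨x, z, θ, t, ρ⟩ ⟨h1, h2, h3, h4, h5, h6⟩
    refine hεG (y := t) ?_ (x, z, θ, ρ) ⟨h1.1, h2, h3, h4, h6⟩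
    rw [Real.dist_eq, sub_zero, abs_of_nonneg h5.1]
    exact h5.2.trans_lt (by linarith))
  obtain ⟨r, hr, hrc⟩ := exists_smooth_inv hc
  -- The gradient divided by its squared length, with the division smoothed where `G < c`.
  let v : Fin nX → Q → ℝ := fun i q => r (G q) * D i q
  have hv : ∀ i, ContDiff ℝ ∞ (v i) := fun i => (hr.comp hG).mul (hD i)
  have hvA : ∀ q ∈ A, q.2 ∈ K → ∑ i, v i q * fderiv ℝ Ψ q (Pi.single i 1, 0) = 1 := by
    intro q hq hqK
    have h1 := hrc _ (hcG q ⟨hq, by simpa using hAR q hq, hqK⟩)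
    refine Eq.trans ?_ h1
    rw [Finset.mul_sum]
    exact Finset.sum_congr rfl fun i _ => by simp only [v, D]; ring
  let c1 : (Fin nX → ℝ) × (Fin nZ → ℝ) → ℝ → ℂ := fun u ρ => a (ρ • u) * χ u
  have hc1 : ContDiff ℝ ∞ fun y : ((Fin nX → ℝ) × (Fin nZ → ℝ)) × ℝ => c1 y.1 y.2 :=
    (ha.comp (contDiff_snd.smul contDiff_fst)).mul
      (Complex.ofRealCLM.contDiff.comp (hχ.comp contDiff_fst))
  let b : Q → ℂ := fun q => c1 (q.1, q.2.1 + q.2.2.2.1 • q.2.2.1) q.2.2.2.2 *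
    starRingEnd ℂ (c1 (q.1, q.2.1) q.2.2.2.2)
  have hb : ContDiff ℝ ∞ b := by
    refine ContDiff.mul ?_ (Complex.conjCLE.contDiff.comp ?_)
    · exact hc1.comp (f := fun q : Q =>
        ((q.1, q.2.1 + q.2.2.2.1 • q.2.2.1), q.2.2.2.2)) (by fun_prop)
    · exact hc1.comp (f := fun q : Q => ((q.1, q.2.1), q.2.2.2.2)) (by fun_prop)
  have hbA : ∀ q ∉ A, b q = 0 := by
    intro q hq
    have : χ (q.1, q.2.1) = 0 := by
      by_contra h
      exact hq (hχs _ h)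
    simp [b, c1, this]
  -- Orders `0` and `N` combine through `(1 + st)ᴺ ≤ 2^(N-1) (1 + (st)ᴺ)`; the large parameter is
  -- `st`, as the phase difference is `t Ψ`.
  obtain ⟨C₀, hC₀, hC₀b⟩ := nonstationary_phase_decay volume (fun i => Pi.single i 1) hΨ hv hA hAR
    hK hvA 0 b hb hbA
  obtain ⟨C₁, hC₁, hC₁b⟩ := nonstationary_phase_decay volume (fun i => Pi.single i 1) hΨ hv hA hAR
    hK hvA N b hb hbA
  refine ⟨2 ^ (N - 1) * (C₀ + C₁), by positivity, fun ρ hρ hρR s hs z w hzw => ?_⟩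
  by_cases hw : ‖w‖ ≤ 2
  swap
  · have : ∀ x, χ (x, w) = 0 := fun x => by
      by_contra h
      exact hw ((le_max_right _ _).trans (hχs _ h).2)
    simp only [this, Complex.ofReal_zero, mul_zero, map_zero, integral_zero, norm_zero]
    positivity
  obtain ⟨θ, hθ, hz⟩ := exists_unit_direction hnZ z w
  set t := ‖z - w‖ with ht
  have ht0 : 0 ≤ t := norm_nonneg _
  have hp : (w, θ, t, ρ) ∈ K := ⟨by simpa using hw, by simpa using hθ, ⟨ht0, hzw⟩, hρ, hρR⟩
  have hI : ∫ x, Complex.exp (Complex.I * s * (phaseEval S x z - phaseEval S x w : ℝ)) *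
      ((a (ρ • (x, z)) * χ (x, z)) * starRingEnd ℂ (a (ρ • (x, w)) * χ (x, w))) =
      ∫ x, Complex.exp (Complex.I * (s * t : ℝ) * Ψ (x, w, θ, t, ρ)) * b (x, w, θ, t, ρ) := by
    congr 1
    ext x
    have h1 := hΨd x w θ t ρ
    rw [← hz] at h1
    rw [h1]
    simp only [b, c1, ← hz]
    congr 2
    push_cast
    ring
  rw [hI]
  have h0 := hC₀b _ hp (s * t) (by positivity)
  have h1 := hC₁b _ hp (s * t) (by positivity)
  rw [pow_zero, one_mul] at h0
  set J := ‖∫ x, Complex.exp (Complex.I * (s * t : ℝ) * Ψ (x, w, θ, t, ρ)) *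
    b (x, w, θ, t, ρ)‖
  have hJ : 0 ≤ J := norm_nonneg _
  calc (1 + s * t) ^ N * J ≤ (2 ^ (N - 1) * (1 ^ N + (s * t) ^ N)) * J := by
        gcongr
        exact add_pow_le zero_le_one (by positivity) N
    _ = 2 ^ (N - 1) * (J + (s * t) ^ N * J) := by rw [one_pow]; ring
    _ ≤ _ := by gcongr

/-- Homogeneity turns the parameter `λ` at scale `ρ` into `λρᵐ` at unit scale. Otherwise `ρ`
survives only in the amplitude `a(ρ ·)`, which stays smooth in `ρ` down to `0`. -/
theorem scaledKernel_smul_mul_conj {m : ℕ} {S : MvPolynomial (Fin nX ⊕ Fin nZ) ℝ}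
    (hS : S.IsHomogeneous m) (a : (Fin nX → ℝ) × (Fin nZ → ℝ) → ℂ)
    (χ : (Fin nX → ℝ) × (Fin nZ → ℝ) → ℝ) (lam : ℝ) {ρ : ℝ} (hρ : ρ ≠ 0) (x : Fin nX → ℝ)
    (z w : Fin nZ → ℝ) :
    scaledKernel S a χ lam ρ (ρ • x, ρ • z) *
        starRingEnd ℂ (scaledKernel S a χ lam ρ (ρ • x, ρ • w)) =
      Complex.exp (Complex.I * (lam * ρ ^ m : ℝ) * (phaseEval S x z - phaseEval S x w : ℝ)) *
        ((a (ρ • (x, z)) * χ (x, z)) * starRingEnd ℂ (a (ρ • (x, w)) * χ (x, w))) := by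
  have h1 : ∀ y : Fin nZ → ℝ, ρ⁻¹ • (ρ • x, ρ • y) = (x, y) := fun y => by
    simp [inv_smul_smul₀ hρ]
  simp only [scaledKernel, h1, phaseEval_smul hS, Prod.smul_mk, map_mul, ← Complex.exp_conj,
    Complex.conj_I, Complex.conj_ofReal]
  have h2 : Complex.exp (Complex.I * (lam * ρ ^ m : ℝ) * (phaseEval S x z - phaseEval S x w : ℝ)) =
      Complex.exp (Complex.I * lam * (ρ ^ m * phaseEval S x z : ℝ)) *
        Complex.exp (-Complex.I * lam * (ρ ^ m * phaseEval S x w : ℝ)) := by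
    rw [← Complex.exp_add]
    congr 1
    push_cast
    ring
  rw [h2]
  ring

/-- The `T*T` bound at scale `ρ`, for functions supported in a set of diameter at most `ρ δ`. -/
theorem exists_local_bound {m : ℕ} (hnZ : 1 ≤ nZ) {S : MvPolynomial (Fin nX ⊕ Fin nZ) ℝ}
    (hS : S.IsHomogeneous m)
    (hrank : ∀ (x : Fin nX → ℝ) (z : Fin nZ → ℝ), (x, z) ≠ (0, 0) →
      (mixedHessian S x z).rank = nZ)
    {a : (Fin nX → ℝ) × (Fin nZ → ℝ) → ℂ} (ha : ContDiff ℝ ∞ a) (hac : HasCompactSupport a)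
    {χ : (Fin nX → ℝ) × (Fin nZ → ℝ) → ℝ} (hχ : ContDiff ℝ ∞ χ)
    (hχs : ∀ u, χ u ≠ 0 → 1 / 2 ≤ ‖u‖ ∧ ‖u‖ ≤ 2) (R : ℝ) :
    ∃ δ : ℝ, 0 < δ ∧ ∃ C : ℝ, 0 ≤ C ∧ ∀ ρ, 0 < ρ → ρ ≤ R → ∀ lam : ℝ, 0 < lam →
      ∀ f : (Fin nZ → ℝ) → ℂ, MemLp f 2 → (∀ z w, f z ≠ 0 → f w ≠ 0 → ‖z - w‖ ≤ ρ * δ) →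
        eLpNorm (fun x => ∫ z, scaledKernel S a χ lam ρ (x, z) * f z) 2 ≤
          ENNReal.ofReal (C * √(ρ ^ (nX + nZ) / (lam * ρ ^ m) ^ nZ)) * eLpNorm f 2 := by
  -- Order `nZ + 1` makes the decay integrable over `z`-space.
  obtain ⟨δ, hδ, C, hC, hdecay⟩ := exists_shell_kernel_decay hnZ hrank ha hχ hχs R (nZ + 1)
  let j : (Fin nZ → ℝ) → ℝ := fun h => ((1 + ‖h‖) ^ (nZ + 1))⁻¹
  have hj : Integrable j := by
    have := integrable_one_add_norm (E := Fin nZ → ℝ) (μ := volume) (r := nZ + 1) (by simp)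
    refine this.congr (Filter.Eventually.of_forall fun h => ?_)
    simp only [j]
    rw [Real.rpow_neg (by positivity), ← Nat.cast_add_one, Real.rpow_natCast]
  have hj0 : ∀ h, 0 ≤ j h := fun h => by positivity
  have hJ : 0 ≤ ∫ h, j h := integral_nonneg hj0
  refine ⟨δ, hδ, √(C * ∫ h, j h), Real.sqrt_nonneg _, fun ρ hρ hρR lam hlam f hf hfs => ?_⟩
  have hr : 0 < lam * ρ ^ m / ρ := by positivity
  -- The factor `ρ ^ nX` is the Jacobian of `x ↦ ρ x`, and `λρᵐ` acts on `ρ⁻¹(z - w)`. Integrating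
  -- `j` after this dilation gains `(ρ / (λρᵐ)) ^ nZ`.
  let g : (Fin nZ → ℝ) → ℝ := fun h => ρ ^ nX * C * j ((lam * ρ ^ m / ρ) • h)
  have hg : Integrable g := (hj.comp_smul hr.ne').const_mul _
  have hg0 : ∀ h, 0 ≤ g h := fun h => mul_nonneg (by positivity) (hj0 _)
  have hgi : ∫ h, g h = C * (∫ h, j h) * (ρ ^ (nX + nZ) / (lam * ρ ^ m) ^ nZ) := by
    simp only [g]
    rw [integral_const_mul, Measure.integral_comp_smul volume j, Module.finrank_fin_fun,
      abs_of_nonneg (by positivity), smul_eq_mul, div_pow, inv_div, pow_add]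
    ring
  have key := eLpNorm_kernel_le (μ := volume) (k := scaledKernel S a χ lam ρ)
    (continuous_scaledKernel S ha.continuous hχ.continuous lam ρ)
    (hasCompactSupport_scaledKernel S hac χ lam ρ) hf hg hg0 (fun z w hz hw => by
      have hzw := hfs z w hz hw
      have hn : ‖ρ⁻¹ • z - ρ⁻¹ • w‖ = ρ⁻¹ * ‖z - w‖ := by
        rw [← smul_sub, norm_smul, norm_inv, Real.norm_of_nonneg hρ.le]
      have h1 := hdecay ρ hρ.le hρR (lam * ρ ^ m) (by positivity) (ρ⁻¹ • z) (ρ⁻¹ • w) (by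
        rw [hn, inv_mul_le_iff₀ hρ]
        exact hzw)
      simp only [← scaledKernel_smul_mul_conj hS a χ lam hρ.ne', smul_inv_smul₀ hρ.ne'] at h1
      rw [Measure.integral_comp_smul volume (fun x => scaledKernel S a χ lam ρ (x, z) *
        starRingEnd ℂ (scaledKernel S a χ lam ρ (x, w))), Module.finrank_fin_fun,
        abs_of_nonneg (by positivity), norm_smul, Real.norm_of_nonneg (by positivity), hn] at h1
      have h2 : ‖(lam * ρ ^ m / ρ) • (z - w)‖ = lam * ρ ^ m * (ρ⁻¹ * ‖z - w‖) := by
        rw [norm_smul, Real.norm_of_nonneg hr.le]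
        ring
      simp only [g, j, h2]
      set s := (1 + lam * ρ ^ m * (ρ⁻¹ * ‖z - w‖)) ^ (nZ + 1)
      have hs : 0 < s := by positivity
      rw [← mul_assoc, mul_comm s, mul_assoc, inv_mul_le_iff₀ (by positivity), mul_comm s] at h1
      rw [← div_eq_mul_inv, le_div_iff₀ hs]
      exact h1)
  rwa [hgi, Real.sqrt_mul (by positivity)] at key

/-- The bound at scale `ρ`, by cutting the `z`-space into finitely many small sets. -/
theorem exists_shell_bound {m : ℕ} (hnZ : 1 ≤ nZ) {S : MvPolynomial (Fin nX ⊕ Fin nZ) ℝ}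
    (hS : S.IsHomogeneous m)
    (hrank : ∀ (x : Fin nX → ℝ) (z : Fin nZ → ℝ), (x, z) ≠ (0, 0) →
      (mixedHessian S x z).rank = nZ)
    {a : (Fin nX → ℝ) × (Fin nZ → ℝ) → ℂ} (ha : ContDiff ℝ ∞ a) (hac : HasCompactSupport a)
    {χ : (Fin nX → ℝ) × (Fin nZ → ℝ) → ℝ} (hχ : ContDiff ℝ ∞ χ)
    (hχs : ∀ u, χ u ≠ 0 → 1 / 2 ≤ ‖u‖ ∧ ‖u‖ ≤ 2) (R : ℝ) :
    ∃ C : ℝ, 0 ≤ C ∧ ∀ ρ, 0 < ρ → ρ ≤ R → ∀ lam : ℝ, 0 < lam →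
      ∀ f : (Fin nZ → ℝ) → ℂ, MemLp f 2 →
        eLpNorm (fun x => ∫ z, scaledKernel S a χ lam ρ (x, z) * f z) 2 ≤
          ENNReal.ofReal (C * √(ρ ^ (nX + nZ) / (lam * ρ ^ m) ^ nZ)) * eLpNorm f 2 := by
  obtain ⟨δ, hδ, C, hC, hloc⟩ := exists_local_bound hnZ hS hrank ha hac hχ hχs R
  have hk := fun lam ρ => continuous_scaledKernel S ha.continuous hχ.continuous lam ρ
  have hkc := fun lam ρ => hasCompactSupport_scaledKernel S hac χ lam ρ
  -- The property passes to subsets and finite unions and holds near each point, so it holds on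
  -- compact sets. The measurable hull `Q` allows `f` to be cut by an indicator.
  let p : Set (Fin nZ → ℝ) → Prop := fun s => ∃ Q, MeasurableSet Q ∧ s ⊆ Q ∧ ∃ C : ℝ, 0 ≤ C ∧
    ∀ ρ, 0 < ρ → ρ ≤ R → ∀ lam : ℝ, 0 < lam →
      ∀ f : (Fin nZ → ℝ) → ℂ, MemLp f 2 → (∀ z, f z ≠ 0 → ρ⁻¹ • z ∈ Q) →
        eLpNorm (fun x => ∫ z, scaledKernel S a χ lam ρ (x, z) * f z) 2 ≤
          ENNReal.ofReal (C * √(ρ ^ (nX + nZ) / (lam * ρ ^ m) ^ nZ)) * eLpNorm f 2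
  have hpre : ∀ {Q : Set (Fin nZ → ℝ)}, MeasurableSet Q → ∀ ρ : ℝ,
      MeasurableSet ((fun z : Fin nZ → ℝ => ρ⁻¹ • z) ⁻¹' Q) := fun hQ ρ =>
    (measurable_const_smul ρ⁻¹) hQ
  have hp : p (Metric.closedBall 0 2) := by
    refine (isCompact_closedBall _ _).induction_on ?_ ?_ ?_ ?_
    · refine ⟨∅, MeasurableSet.empty, subset_rfl, 0, le_rfl, fun ρ _ _ lam _ f _ hfs => ?_⟩
      have : f = 0 := by
        ext z
        by_contra h
        exact hfs z h
      simp [this]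
    · rintro s t hst ⟨Q, hQ, htQ, h⟩
      exact ⟨Q, hQ, hst.trans htQ, h⟩
    · rintro s t ⟨Q₁, hQ₁, hs, C₁, hC₁, h₁⟩ ⟨Q₂, hQ₂, ht, C₂, hC₂, h₂⟩
      refine ⟨Q₁ ∪ Q₂, hQ₁.union hQ₂, Set.union_subset_union hs ht, C₁ + C₂, by positivity,
        fun ρ hρ hρR lam hlam f hf hfs => ?_⟩
      set B := (fun z : Fin nZ → ℝ => ρ⁻¹ • z) ⁻¹' Q₁ with hB
      have hBm : MeasurableSet B := hpre hQ₁ ρ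
      have hf₁ : MemLp (B.indicator f) 2 := hf.indicator hBm
      have hf₂ : MemLp (Bᶜ.indicator f) 2 := hf.indicator hBm.compl
      have e₁ := h₁ ρ hρ hρR lam hlam _ hf₁ fun z hz =>
        show z ∈ B from Set.mem_of_indicator_ne_zero hz
      have e₂ := h₂ ρ hρ hρR lam hlam _ hf₂ fun z hz => by
        have hz1 : z ∈ Bᶜ := Set.mem_of_indicator_ne_zero hz
        rw [Set.indicator_of_mem hz1] at hz
        exact (hfs z hz).resolve_left hz1
      have hsum : (fun x => ∫ z, scaledKernel S a χ lam ρ (x, z) * f z) =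
          (fun x => ∫ z, scaledKernel S a χ lam ρ (x, z) * B.indicator f z) +
            fun x => ∫ z, scaledKernel S a χ lam ρ (x, z) * Bᶜ.indicator f z := by
        ext x
        rw [Pi.add_apply, ← integral_add (integrable_kernel_mul (hk lam ρ) (hkc lam ρ) hf₁ x)
          (integrable_kernel_mul (hk lam ρ) (hkc lam ρ) hf₂ x)]
        simp only [← mul_add]
        congr 1
        ext z
        rw [← Pi.add_apply, Set.indicator_self_add_compl]
      rw [hsum]
      refine (eLpNorm_add_le (aestronglyMeasurable_kernel_mul (hk lam ρ) hf₁.aestronglyMeasurable)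
        (aestronglyMeasurable_kernel_mul (hk lam ρ) hf₂.aestronglyMeasurable) (by norm_num)).trans ?_
      rw [add_mul C₁, ENNReal.ofReal_add (by positivity) (by positivity), add_mul]
      gcongr
      · exact e₁.trans (by gcongr; exact eLpNorm_indicator_le f)
      · exact e₂.trans (by gcongr; exact eLpNorm_indicator_le f)
    · intro y _
      -- Radius `δ / 2` gives diameter at most `δ`, as the local bound requires.
      refine ⟨Metric.ball y (δ / 2), mem_nhdsWithin_of_mem_nhds (Metric.ball_mem_nhds y (by positivity)),
        Metric.ball y (δ / 2), measurableSet_ball, subset_rfl, C, hC,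
        fun ρ hρ hρR lam hlam f hf hfs => hloc ρ hρ hρR lam hlam f hf fun z w hz hw => ?_⟩
      have h1 : dist (ρ⁻¹ • z) (ρ⁻¹ • w) < δ := by
        have := dist_triangle_right (ρ⁻¹ • z) (ρ⁻¹ • w) y
        have h3 := Metric.mem_ball.1 (hfs z hz)
        have h4 := Metric.mem_ball.1 (hfs w hw)
        linarith
      rw [dist_eq_norm, ← smul_sub, norm_smul, norm_inv, Real.norm_of_nonneg hρ.le,
        inv_mul_lt_iff₀ hρ] at h1
      exact h1.le
  obtain ⟨Q, hQ, hQs, C', hC', h⟩ := hp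
  refine ⟨C', hC', fun ρ hρ hρR lam hlam f hf => ?_⟩
  set B := (fun z : Fin nZ → ℝ => ρ⁻¹ • z) ⁻¹' Q with hB
  have hBm : MeasurableSet B := hpre hQ ρ
  have hf₁ : MemLp (B.indicator f) 2 := hf.indicator hBm
  have e₁ := h ρ hρ hρR lam hlam _ hf₁ fun z hz =>
    show z ∈ B from Set.mem_of_indicator_ne_zero hz
  -- Outside `B` the rescaled `z` has norm above `2`, where the cutoff vanishes for every `x`.
  have heq : ∀ x z, scaledKernel S a χ lam ρ (x, z) * B.indicator f z =
      scaledKernel S a χ lam ρ (x, z) * f z := by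
    intro x z
    by_cases hz : z ∈ B
    · rw [Set.indicator_of_mem hz]
    · have : χ (ρ⁻¹ • (x, z)) = 0 := by
        by_contra h0
        refine hz (hQs ?_)
        rw [mem_closedBall_zero_iff]
        exact (le_max_right _ _).trans (hχs _ h0).2
      simp only [scaledKernel, this, Complex.ofReal_zero, mul_zero, zero_mul]
  simp only [heq] at e₁
  exact e₁.trans (by gcongr; exact eLpNorm_indicator_le f)

/-- The trivial bound for the piece in the ball of radius `2ρ`. -/
theorem exists_ball_bound (S : MvPolynomial (Fin nX ⊕ Fin nZ) ℝ)
    {a : (Fin nX → ℝ) × (Fin nZ → ℝ) → ℂ} (ha : Continuous a) (hac : HasCompactSupport a)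
    {χ : (Fin nX → ℝ) × (Fin nZ → ℝ) → ℝ} (hχ : Continuous χ)
    (hχs : ∀ u, χ u ≠ 0 → ‖u‖ ≤ 2) (hχ1 : ∀ u, |χ u| ≤ 1) :
    ∃ C : ℝ, 0 ≤ C ∧ ∀ ρ, 0 < ρ → ∀ lam : ℝ,
      ∀ f : (Fin nZ → ℝ) → ℂ, MemLp f 2 →
        eLpNorm (fun x => ∫ z, scaledKernel S a χ lam ρ (x, z) * f z) 2 ≤
          ENNReal.ofReal (C * √(ρ ^ (nX + nZ))) * eLpNorm f 2 := by
  obtain ⟨M, hM⟩ := hac.exists_bound_of_continuous ha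
  have hM0 : 0 ≤ M := (norm_nonneg _).trans (hM 0)
  -- Balls are cubes in the sup norm. The kernel of `T*T` is at most `M²` times the volume `(4ρ) ^
  -- nX` of `‖x‖ ≤ 2ρ`, and vanishes unless `‖z - w‖ ≤ 4ρ`, a set of volume `(8ρ) ^ nZ`.
  refine ⟨√(M ^ 2 * 4 ^ nX * 8 ^ nZ), Real.sqrt_nonneg _, fun ρ hρ lam f hf => ?_⟩
  have hkM : ∀ u, ‖scaledKernel S a χ lam ρ u‖ ≤ M := by
    intro u
    rw [scaledKernel, norm_mul, norm_mul, mul_assoc, mul_comm Complex.I, ← Complex.ofReal_mul,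
      Complex.norm_exp_ofReal_mul_I, one_mul, Complex.norm_real]
    calc ‖a u‖ * ‖χ (ρ⁻¹ • u)‖ ≤ M * 1 := by
          gcongr
          · exact hM u
          · exact hχ1 _
      _ = M := mul_one M
  have hk0 : ∀ u, 2 * ρ < ‖u‖ → scaledKernel S a χ lam ρ u = 0 := by
    intro u hu
    have : χ (ρ⁻¹ • u) = 0 := by
      by_contra h
      have := hχs _ h
      rw [norm_smul, norm_inv, Real.norm_of_nonneg hρ.le, inv_mul_le_iff₀ hρ] at this
      linarith
    simp [scaledKernel, this]
  let g : (Fin nZ → ℝ) → ℝ := (Metric.closedBall 0 (4 * ρ)).indicator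
    fun _ => M ^ 2 * (4 * ρ) ^ nX
  have hg : Integrable g := (integrable_indicator_iff measurableSet_closedBall).2
    (integrableOn_const measure_closedBall_lt_top.ne)
  have hg0 : ∀ h, 0 ≤ g h := fun h => Set.indicator_nonneg (fun _ _ => by positivity) _
  have hgi : ∫ h, g h = M ^ 2 * 4 ^ nX * 8 ^ nZ * ρ ^ (nX + nZ) := by
    simp only [g]
    rw [integral_indicator measurableSet_closedBall, setIntegral_const, measureReal_def,
      Real.volume_pi_closedBall _ (by positivity), ENNReal.toReal_ofReal (by positivity),
      Fintype.card_fin, smul_eq_mul, show 2 * (4 * ρ) = 8 * ρ by ring, pow_add,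
      mul_pow, mul_pow]
    ring
  have key := eLpNorm_kernel_le (μ := volume) (k := scaledKernel S a χ lam ρ)
    (continuous_scaledKernel S ha hχ lam ρ)
    (hasCompactSupport_scaledKernel S hac χ lam ρ) hf hg hg0 (fun z w hz hw => by
      by_cases h : ‖z‖ ≤ 2 * ρ ∧ ‖w‖ ≤ 2 * ρ
      · have hzw : z - w ∈ Metric.closedBall 0 (4 * ρ) := by
          rw [mem_closedBall_zero_iff]
          exact (norm_sub_le z w).trans (by linarith [h.1, h.2])
        simp only [g]
        rw [Set.indicator_of_mem hzw]
        rw [← setIntegral_eq_integral_of_forall_compl_eq_zero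
          (s := Metric.closedBall 0 (2 * ρ)) fun x hx => ?_]
        · refine (norm_setIntegral_le_of_norm_le_const measure_closedBall_lt_top
            (C := M ^ 2) fun x _ => ?_).trans ?_
          · rw [norm_mul, RCLike.norm_conj, sq]
            gcongr <;> exact hkM _
          · rw [measureReal_def, Real.volume_pi_closedBall _ (by positivity),
              ENNReal.toReal_ofReal (by positivity), Fintype.card_fin,
              show 2 * (2 * ρ) = 4 * ρ by ring]
        · rw [mem_closedBall_zero_iff, not_le] at hx
          rw [hk0 _ (hx.trans_le (le_max_left _ _)), zero_mul]
      · have : ∀ x, scaledKernel S a χ lam ρ (x, z) *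
            starRingEnd ℂ (scaledKernel S a χ lam ρ (x, w)) = 0 := by
          intro x
          rw [not_and_or, not_le, not_le] at h
          rcases h with h | h
          · rw [hk0 _ (h.trans_le (le_max_right _ _)), zero_mul]
          · rw [hk0 (x, w) (h.trans_le (le_max_right _ _)), map_zero, mul_zero]
        simp only [this, integral_zero, norm_zero]
        exact hg0 _)
  rwa [hgi, Real.sqrt_mul (by positivity)] at key

end Dyadic

/-! ### Summation of the dyadic pieces -/

section Summation

variable {nX nZ : ℕ}

theorem sqrt_pow_of_nonneg {x : ℝ} (hx : 0 ≤ x) (j : ℕ) : √(x ^ j) = √x ^ j := by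
  rw [Real.sqrt_eq_iff_mul_self_eq (by positivity) (by positivity), ← mul_pow,
    Real.mul_self_sqrt hx]

/-- Isolates the dependence on the shell index as a pure power, whose base compared with `1` decides
the regime. -/
theorem sqrt_shell_factor (n k m j : ℕ) {R lam : ℝ} (hR : 0 < R) (hlam : 0 < lam) :
    √((R * ((2 : ℝ) ^ j)⁻¹) ^ n / (lam * (R * ((2 : ℝ) ^ j)⁻¹) ^ m) ^ k) =
      √(R ^ n / R ^ (m * k)) * ((√(lam ^ k))⁻¹ * √(2 ^ (m * k) / 2 ^ n) ^ j) := by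
  rw [← Real.sqrt_inv, ← sqrt_pow_of_nonneg (by positivity), ← Real.sqrt_mul (by positivity),
    ← Real.sqrt_mul (by positivity)]
  congr 1
  rw [mul_pow lam, ← pow_mul, mul_pow, mul_pow, inv_pow, inv_pow, div_pow, ← pow_mul, ← pow_mul,
    ← pow_mul, ← pow_mul, mul_comm j, mul_comm j]
  field_simp

theorem sqrt_ball_factor (n j : ℕ) {R : ℝ} (hR : 0 < R) :
    √((R * ((2 : ℝ) ^ j)⁻¹) ^ n) = √(R ^ n) * (√(2 ^ n) ^ j)⁻¹ := by
  rw [← sqrt_pow_of_nonneg (by positivity), ← Real.sqrt_inv, ← Real.sqrt_mul (by positivity)]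
  congr 1
  rw [mul_pow, inv_pow, ← pow_mul, ← pow_mul, mul_comm j]

/-- Taking `χ` as the difference of one bump at two consecutive scales makes dyadic sums telescope;
where the two bumps agree, near the origin and far away, `χ` vanishes. -/
theorem exists_dyadic_cutoffs (G : Type*) [NormedAddCommGroup G] [NormedSpace ℝ G]
    [FiniteDimensional ℝ G] :
    ∃ χ₀ χ : G → ℝ, ContDiff ℝ ∞ χ₀ ∧ ContDiff ℝ ∞ χ ∧ (∀ u, χ₀ u ≠ 0 → ‖u‖ ≤ 2) ∧
      (∀ u, |χ₀ u| ≤ 1) ∧ (∀ u, ‖u‖ ≤ 1 → χ₀ u = 1) ∧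
      (∀ u, χ u ≠ 0 → 1 / 2 ≤ ‖u‖ ∧ ‖u‖ ≤ 2) ∧ ∀ u, χ u = χ₀ u - χ₀ ((2 : ℝ) • u) := by
  let χ₀ : ContDiffBump (0 : G) := ⟨1, 2, one_pos, one_lt_two⟩
  have hχ₀s : ∀ u, χ₀ u ≠ 0 → ‖u‖ ≤ 2 := fun u hu => by
    by_contra h
    exact hu (χ₀.zero_of_le_dist (by rw [dist_zero_right]; exact (not_le.1 h).le))
  have hχ₀1 : ∀ u, ‖u‖ ≤ 1 → χ₀ u = 1 := fun u hu =>
    χ₀.one_of_mem_closedBall (by rw [mem_closedBall_zero_iff]; exact hu)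
  refine ⟨χ₀, fun u => χ₀ u - χ₀ ((2 : ℝ) • u), χ₀.contDiff,
    χ₀.contDiff.sub (χ₀.contDiff.comp (contDiff_const_smul _)), hχ₀s,
    fun u => by rw [abs_of_nonneg χ₀.nonneg]; exact χ₀.le_one, hχ₀1, fun u hu => ?_, fun _ => rfl⟩
  have h2 : ‖(2 : ℝ) • u‖ = 2 * ‖u‖ := by rw [norm_smul]; norm_num
  replace hu : χ₀ u - χ₀ ((2 : ℝ) • u) ≠ 0 := hu
  constructor
  · by_contra h
    exact hu (by rw [hχ₀1 u (by linarith), hχ₀1 _ (by rw [h2]; linarith), sub_self])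
  · by_contra h
    exact hu (by rw [not_not.1 (mt (hχ₀s u) h),
      not_not.1 (mt (hχ₀s ((2 : ℝ) • u)) (by rw [h2]; linarith)), sub_self])

/-- The cutoffs telescope to `χ₀(u / R)`, which is one wherever `a` is nonzero. -/
theorem sum_scaledKernel (S : MvPolynomial (Fin nX ⊕ Fin nZ) ℝ)
    {a : (Fin nX → ℝ) × (Fin nZ → ℝ) → ℂ} {R : ℝ} (hR : 0 < R) (ha : ∀ u, R < ‖u‖ → a u = 0)
    {χ₀ χ : (Fin nX → ℝ) × (Fin nZ → ℝ) → ℝ} (hχ₀ : ∀ u, ‖u‖ ≤ 1 → χ₀ u = 1)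
    (hχ : ∀ u, χ u = χ₀ u - χ₀ ((2 : ℝ) • u)) (lam : ℝ) (J : ℕ)
    (u : (Fin nX → ℝ) × (Fin nZ → ℝ)) :
    Complex.exp (Complex.I * (lam : ℂ) * (phaseEval S u.1 u.2 : ℂ)) * a u =
      (∑ j ∈ Finset.range J, scaledKernel S a χ lam (R * ((2 : ℝ) ^ j)⁻¹) u) +
        scaledKernel S a χ₀ lam (R * ((2 : ℝ) ^ J)⁻¹) u := by
  have htel : ∀ j : ℕ, χ ((R * ((2 : ℝ) ^ j)⁻¹)⁻¹ • u) =
      χ₀ ((R * ((2 : ℝ) ^ j)⁻¹)⁻¹ • u) - χ₀ ((R * ((2 : ℝ) ^ (j + 1))⁻¹)⁻¹ • u) := by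
    intro j
    rw [hχ, smul_smul]
    congr 3
    rw [pow_succ, mul_inv, mul_inv, inv_inv, inv_inv]
    ring
  have h0 : a u * χ₀ ((R * ((2 : ℝ) ^ 0)⁻¹)⁻¹ • u) = a u := by
    rw [pow_zero, inv_one, mul_one]
    by_cases h : ‖u‖ ≤ R
    · rw [hχ₀, Complex.ofReal_one, mul_one]
      rwa [norm_smul, norm_inv, Real.norm_of_nonneg hR.le, inv_mul_le_iff₀ hR, mul_one]
    · rw [ha u (not_le.1 h), zero_mul]
  simp only [scaledKernel, ← Finset.mul_sum, ← mul_add, ← Complex.ofReal_sum,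
    ← Complex.ofReal_add, htel]
  rw [Finset.sum_range_sub' (fun j => χ₀ ((R * ((2 : ℝ) ^ j)⁻¹)⁻¹ • u)), sub_add_cancel, h0]

/-- Triangle inequality over the pieces. The constant is independent of `J`, which is left free to
be chosen in terms of `λ`. -/
theorem exists_dyadic_bound {m : ℕ} (hnZ : 1 ≤ nZ) {S : MvPolynomial (Fin nX ⊕ Fin nZ) ℝ}
    (hS : S.IsHomogeneous m)
    (hrank : ∀ (x : Fin nX → ℝ) (z : Fin nZ → ℝ), (x, z) ≠ (0, 0) →
      (mixedHessian S x z).rank = nZ)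
    {a : (Fin nX → ℝ) × (Fin nZ → ℝ) → ℂ} (ha : ContDiff ℝ ∞ a) (hac : HasCompactSupport a) :
    ∃ C : ℝ, 0 ≤ C ∧ ∀ J : ℕ, ∀ lam : ℝ, 0 < lam → ∀ f : (Fin nZ → ℝ) → ℂ, MemLp f 2 →
      eLpNorm (oscIntegral S a lam f) 2 ≤
        ENNReal.ofReal (C * ((√(lam ^ nZ))⁻¹ * ∑ j ∈ Finset.range J,
          √(2 ^ (m * nZ) / 2 ^ (nX + nZ)) ^ j + (√(2 ^ (nX + nZ)) ^ J)⁻¹)) * eLpNorm f 2 := by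
  obtain ⟨R₀, hR₀⟩ := hac.exists_radius
  obtain ⟨R, hRpos, hR⟩ : ∃ R : ℝ, 0 < R ∧ ∀ u, R < ‖u‖ → a u = 0 :=
    ⟨max R₀ 1, by positivity, fun u hu => hR₀ u ((le_max_left _ _).trans_lt hu)⟩
  obtain ⟨χ₀, χ, hχ₀, hχ, hχ₀s, hχ₀b, hχ₀1, hχs, hχχ₀⟩ :=
    exists_dyadic_cutoffs ((Fin nX → ℝ) × (Fin nZ → ℝ))
  obtain ⟨C₁, hC₁, h₁⟩ := exists_shell_bound hnZ hS hrank ha hac hχ hχs R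
  obtain ⟨C₂, hC₂, h₂⟩ := exists_ball_bound S ha.continuous hac hχ₀.continuous hχ₀s hχ₀b
  refine ⟨C₁ * √(R ^ (nX + nZ) / R ^ (m * nZ)) + C₂ * √(R ^ (nX + nZ)), by positivity,
    fun J lam hlam f hf => ?_⟩
  let r : ℕ → ℝ := fun j => R * ((2 : ℝ) ^ j)⁻¹
  have hr : ∀ j, 0 < r j := fun j => by positivity
  have hrR : ∀ j, r j ≤ R := fun j =>
    mul_le_of_le_one_right hRpos.le (inv_le_one_of_one_le₀ (one_le_pow₀ one_le_two))
  have hker := sum_scaledKernel S hRpos hR hχ₀1 hχχ₀ lam J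
  have hk : ∀ j, Continuous (scaledKernel S a χ lam (r j)) := fun j =>
    continuous_scaledKernel S ha.continuous hχ.continuous lam (r j)
  have hkc : ∀ j, HasCompactSupport (scaledKernel S a χ lam (r j)) := fun j =>
    hasCompactSupport_scaledKernel S hac χ lam (r j)
  have hk₀ : Continuous (scaledKernel S a χ₀ lam (r J)) :=
    continuous_scaledKernel S ha.continuous hχ₀.continuous lam (r J)
  have hkc₀ : HasCompactSupport (scaledKernel S a χ₀ lam (r J)) :=
    hasCompactSupport_scaledKernel S hac χ₀ lam (r J)
  have hdec : oscIntegral S a lam f =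
      (∑ j ∈ Finset.range J, fun x => ∫ z, scaledKernel S a χ lam (r j) (x, z) * f z) +
        fun x => ∫ z, scaledKernel S a χ₀ lam (r J) (x, z) * f z := by
    ext x
    rw [Pi.add_apply, Finset.sum_apply,
      ← integral_finsetSum _ fun j _ => integrable_kernel_mul (hk j) (hkc j) hf x,
      ← integral_add (integrable_finsetSum _ fun j _ => integrable_kernel_mul (hk j) (hkc j) hf x)
        (integrable_kernel_mul hk₀ hkc₀ hf x)]
    refine integral_congr_ae (Filter.Eventually.of_forall fun z => ?_)
    have := hker (x, z)
    simp only at this ⊢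
    rw [this, add_mul, Finset.sum_mul]
  have hm1 : ∀ j, AEStronglyMeasurable
      (fun x => ∫ z, scaledKernel S a χ lam (r j) (x, z) * f z) volume := fun j =>
    aestronglyMeasurable_kernel_mul (hk j) hf.aestronglyMeasurable
  have hshell : ∀ j, √(r j ^ (nX + nZ) / (lam * r j ^ m) ^ nZ) =
      √(R ^ (nX + nZ) / R ^ (m * nZ)) *
        ((√(lam ^ nZ))⁻¹ * √(2 ^ (m * nZ) / 2 ^ (nX + nZ)) ^ j) := fun j =>
    sqrt_shell_factor _ _ _ _ hRpos hlam
  have hball : √(r J ^ (nX + nZ)) = √(R ^ (nX + nZ)) * (√(2 ^ (nX + nZ)) ^ J)⁻¹ :=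
    sqrt_ball_factor _ _ hRpos
  set X := (√(lam ^ nZ))⁻¹ * ∑ j ∈ Finset.range J, √(2 ^ (m * nZ) / 2 ^ (nX + nZ)) ^ j with hX
  set Y := (√(2 ^ (nX + nZ)) ^ J)⁻¹ with hY
  have hX0 : 0 ≤ X := by positivity
  have hY0 : 0 ≤ Y := by positivity
  have hbound : (∑ j ∈ Finset.range J, C₁ * √(r j ^ (nX + nZ) / (lam * r j ^ m) ^ nZ)) +
      C₂ * √(r J ^ (nX + nZ)) ≤
      (C₁ * √(R ^ (nX + nZ) / R ^ (m * nZ)) + C₂ * √(R ^ (nX + nZ))) * (X + Y) := by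
    have e1 : 0 ≤ C₁ * √(R ^ (nX + nZ) / R ^ (m * nZ)) := by positivity
    have e2 : 0 ≤ C₂ * √(R ^ (nX + nZ)) := by positivity
    simp only [hshell, hball]
    rw [← Finset.mul_sum, ← Finset.mul_sum, ← Finset.mul_sum]
    linarith [mul_nonneg e1 hY0, mul_nonneg e2 hX0]
  have htri : eLpNorm (oscIntegral S a lam f) 2 ≤ (∑ j ∈ Finset.range J,
      eLpNorm (fun x => ∫ z, scaledKernel S a χ lam (r j) (x, z) * f z) 2) +
        eLpNorm (fun x => ∫ z, scaledKernel S a χ₀ lam (r J) (x, z) * f z) 2 := by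
    rw [hdec]
    exact (eLpNorm_add_le (Finset.aestronglyMeasurable_sum _ fun j _ => hm1 j)
      (aestronglyMeasurable_kernel_mul hk₀ hf.aestronglyMeasurable) (by norm_num)).trans
        (add_le_add (eLpNorm_sum_le (fun j _ => hm1 j) (by norm_num)) le_rfl)
  refine (htri.trans (add_le_add (Finset.sum_le_sum fun j _ => h₁ (r j) (hr j) (hrR j) lam hlam f hf)
    (h₂ (r J) (hr J) lam f hf))).trans ?_
  rw [← Finset.sum_mul, ← add_mul, ← ENNReal.ofReal_sum_of_nonneg fun j _ => by positivity,
    ← ENNReal.ofReal_add (Finset.sum_nonneg fun j _ => by positivity) (by positivity)]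
  exact mul_le_mul' (ENNReal.ofReal_le_ofReal hbound) le_rfl

/-- The choice of the number of dyadic scales, `2 ^ J ≈ lam ^ (1 / m)`. -/
theorem exists_dyadic_scale {m : ℕ} {lam : ℝ} (hlam : 2 ≤ lam) :
    ∃ J : ℕ, lam ^ ((1 : ℝ) / m) ≤ 2 ^ J ∧ (2 : ℝ) ^ J ≤ 2 * lam ^ ((1 : ℝ) / m) := by
  obtain ⟨n, h1, h2⟩ := exists_nat_pow_near
    (Real.one_le_rpow (by linarith : (1 : ℝ) ≤ lam) (by positivity : (0 : ℝ) ≤ 1 / m)) one_lt_two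
  exact ⟨n + 1, h2.le, by rw [pow_succ, mul_comm]; gcongr⟩

theorem exists_sum_bound {nX nZ m : ℕ} (hnZ : 1 ≤ nZ) (hm : 3 ≤ m) :
    ∃ C : ℝ, 0 < C ∧ ∀ lam : ℝ, 2 ≤ lam → ∃ J : ℕ, ∃ B : ℝ,
      (√(lam ^ nZ))⁻¹ * ∑ j ∈ Finset.range J, √(2 ^ (m * nZ) / 2 ^ (nX + nZ)) ^ j +
        (√(2 ^ (nX + nZ)) ^ J)⁻¹ = B ∧
        ((m : ℝ) > ((nX : ℝ) + nZ) / nZ → B ≤ C * lam ^ (-(((nX : ℝ) + nZ) / (2 * m)))) ∧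
        ((m : ℝ) = ((nX : ℝ) + nZ) / nZ → B ≤ C * lam ^ (-((nZ : ℝ) / 2)) * Real.log lam) ∧
        ((m : ℝ) < ((nX : ℝ) + nZ) / nZ → B ≤ C * lam ^ (-((nZ : ℝ) / 2))) := by
  have hnZ' : (0 : ℝ) < nZ := by exact_mod_cast hnZ
  have hm' : (0 : ℝ) < m := by exact_mod_cast (by omega : 0 < m)
  -- The ratio is `2 ^ κ`, and the sign of `κ` is that of `m - (nX + nZ) / nZ`.
  set κ : ℝ := (m * nZ - (nX + nZ)) / 2 with hκ
  set q : ℝ := √(2 ^ (m * nZ) / 2 ^ (nX + nZ)) with hq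
  have hqκ : q = 2 ^ κ := by
    rw [hq, Real.sqrt_eq_rpow, ← Real.rpow_natCast, ← Real.rpow_natCast,
      ← Real.rpow_sub two_pos, ← Real.rpow_mul two_pos.le, hκ]
    push_cast
    congr 1
    ring
  have hq0 : 0 < q := by rw [hqκ]; positivity
  have hlamZ : ∀ lam : ℝ, 2 ≤ lam → (√(lam ^ nZ))⁻¹ = lam ^ (-((nZ : ℝ) / 2)) := by
    intro lam hlam
    have : 0 ≤ lam := by linarith
    rw [Real.sqrt_eq_rpow, ← Real.rpow_natCast, ← Real.rpow_mul this, ← Real.rpow_neg this]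
    congr 1
    ring
  have hrem : ∀ lam : ℝ, 2 ≤ lam → ∀ J : ℕ, lam ^ ((1 : ℝ) / m) ≤ 2 ^ J →
      (√(2 ^ (nX + nZ)) ^ J)⁻¹ ≤ lam ^ (-(((nX : ℝ) + nZ) / (2 * m))) := by
    intro lam hlam J hJ
    have hl : 0 < lam := by linarith
    have h1 : √(2 ^ (nX + nZ)) ^ J = ((2 : ℝ) ^ J) ^ (((nX : ℝ) + nZ) / 2) := by
      rw [Real.sqrt_eq_rpow, ← Real.rpow_natCast, ← Real.rpow_natCast, ← Real.rpow_natCast,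
        ← Real.rpow_mul two_pos.le, ← Real.rpow_mul two_pos.le, ← Real.rpow_mul two_pos.le]
      push_cast
      congr 1
      ring
    rw [h1, Real.rpow_neg hl.le]
    have h2 : lam ^ (((nX : ℝ) + nZ) / (2 * m)) = (lam ^ ((1 : ℝ) / m)) ^ (((nX : ℝ) + nZ) / 2) := by
      rw [← Real.rpow_mul hl.le]
      congr 1
      field_simp
    rw [h2]
    gcongr
  rcases lt_trichotomy (m : ℝ) (((nX : ℝ) + nZ) / nZ) with h | h | h
  · have hlt : (m : ℝ) * nZ < nX + nZ := (lt_div_iff₀ hnZ').1 h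
    have hq1 : q < 1 := by
      rw [hqκ]
      exact Real.rpow_lt_one_of_one_lt_of_neg one_lt_two (by rw [hκ]; linarith)
    refine ⟨(1 - q)⁻¹ + 1, by have := sub_pos.2 hq1; positivity, fun lam hlam => ?_⟩
    obtain ⟨J, hJ, -⟩ := exists_dyadic_scale (m := m) hlam
    refine ⟨J, _, rfl, fun h' => absurd h' (not_lt.2 h.le), fun h' => absurd h' h.ne, fun _ => ?_⟩
    have hl : 0 < lam := by linarith
    have hs : ∑ j ∈ Finset.range J, q ^ j ≤ (1 - q)⁻¹ := by
      rw [← tsum_geometric_of_lt_one hq0.le hq1]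
      exact (summable_geometric_of_lt_one hq0.le hq1).sum_le_tsum _ fun j _ => by positivity
    -- Here `(nX + nZ) / (2m)` exceeds `nZ / 2`, so the ball piece is absorbed.
    have hr : lam ^ (-(((nX : ℝ) + nZ) / (2 * m))) ≤ lam ^ (-((nZ : ℝ) / 2)) := by
      refine Real.rpow_le_rpow_of_exponent_le (by linarith) (neg_le_neg ?_)
      rw [div_le_div_iff₀ two_pos (by positivity)]
      nlinarith
    rw [hlamZ lam hlam, add_mul, one_mul, mul_comm (1 - q)⁻¹]
    exact add_le_add (by gcongr) ((hrem lam hlam J hJ).trans hr)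
  · have heq : (m : ℝ) * nZ = nX + nZ := (eq_div_iff hnZ'.ne').1 h
    have hq1 : q = 1 := by
      rw [hqκ, hκ, heq]
      simp
    have hlog2 : 0 < Real.log 2 := Real.log_pos one_lt_two
    -- Two parts come from `J ≤ 2 log λ / log 2`; the third covers the ball piece, using `log λ /
    -- log 2 ≥ 1`.
    refine ⟨3 / Real.log 2, by positivity, fun lam hlam => ?_⟩
    obtain ⟨J, hJ, hJ2⟩ := exists_dyadic_scale (m := m) hlam
    refine ⟨J, _, rfl, fun h' => absurd h h'.ne', fun _ => ?_, fun h' => absurd h h'.ne⟩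
    have hl : 0 < lam := by linarith
    have hlog : Real.log 2 ≤ Real.log lam := Real.log_le_log two_pos hlam
    have hJlog : (J : ℝ) * Real.log 2 ≤ 2 * Real.log lam := by
      have h1 := Real.log_le_log (by positivity) hJ2
      rw [Real.log_pow, Real.log_mul two_ne_zero (by positivity), Real.log_rpow hl] at h1
      have h2 : 1 / (m : ℝ) * Real.log lam ≤ 1 * Real.log lam := by
        have : (1 : ℝ) / m ≤ 1 := by
          rw [div_le_one hm']
          exact_mod_cast (by omega : 1 ≤ m)
        gcongr
        linarith
      linarith
    have hr : lam ^ (-(((nX : ℝ) + nZ) / (2 * m))) = lam ^ (-((nZ : ℝ) / 2)) := by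
      congr 2
      rw [← heq]
      field_simp
    have hr' := hrem lam hlam J hJ
    rw [hr] at hr'
    rw [hlamZ lam hlam, hq1]
    simp only [one_pow, Finset.sum_const, Finset.card_range, nsmul_eq_mul, mul_one]
    have hL : (0 : ℝ) < lam ^ (-((nZ : ℝ) / 2)) := by positivity
    calc lam ^ (-((nZ : ℝ) / 2)) * J + (√(2 ^ (nX + nZ)) ^ J)⁻¹
        ≤ lam ^ (-((nZ : ℝ) / 2)) * (2 * Real.log lam / Real.log 2) +
          lam ^ (-((nZ : ℝ) / 2)) * (Real.log lam / Real.log 2) := by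
          gcongr
          · rwa [le_div_iff₀ hlog2]
          · refine hr'.trans (le_mul_of_one_le_right hL.le ?_)
            rwa [one_le_div hlog2]
      _ = _ := by ring
  · have hgt : (nX : ℝ) + nZ < m * nZ := (div_lt_iff₀ hnZ').1 h
    have hκ0 : 0 < κ := by rw [hκ]; linarith
    have hq1 : 1 < q := by
      rw [hqκ]
      exact Real.one_lt_rpow one_lt_two hκ0
    have hq1' : 0 < q - 1 := sub_pos.2 hq1
    refine ⟨q / (q - 1) + 1, by positivity, fun lam hlam => ?_⟩
    obtain ⟨J, hJ, hJ2⟩ := exists_dyadic_scale (m := m) hlam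
    refine ⟨J, _, rfl, fun _ => ?_, fun h' => absurd h' h.ne', fun h' => absurd h' (not_lt.2 h.le)⟩
    have hl : 0 < lam := by linarith
    -- The last shell dominates the growing series, and `κ / m - nZ / 2 = -(nX + nZ) / (2m)`, the
    -- exponent of the ball piece.
    have hqJ : q ^ J ≤ q * lam ^ (κ / m) := by
      have h1 : q ^ J = ((2 : ℝ) ^ J) ^ κ := by
        rw [hqκ, ← Real.rpow_natCast, ← Real.rpow_natCast, ← Real.rpow_mul two_pos.le,
          ← Real.rpow_mul two_pos.le, mul_comm]
      have h2 : q * lam ^ (κ / m) = (2 * lam ^ ((1 : ℝ) / m)) ^ κ := by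
        rw [Real.mul_rpow two_pos.le (by positivity), ← Real.rpow_mul hl.le, hqκ]
        congr 2
        ring
      rw [h1, h2]
      gcongr
    have hs : ∑ j ∈ Finset.range J, q ^ j ≤ q / (q - 1) * lam ^ (κ / m) := by
      rw [geom_sum_eq hq1.ne', div_mul_eq_mul_div]
      gcongr
      linarith
    have hexp : lam ^ (-((nZ : ℝ) / 2)) * lam ^ (κ / m) =
        lam ^ (-(((nX : ℝ) + nZ) / (2 * m))) := by
      rw [← Real.rpow_add hl, hκ]
      congr 1
      field_simp
      ring
    rw [hlamZ lam hlam, add_mul, one_mul, ← hexp]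
    refine add_le_add ?_ ?_
    · calc _ ≤ lam ^ (-((nZ : ℝ) / 2)) * (q / (q - 1) * lam ^ (κ / m)) := by gcongr
        _ = _ := by ring
    · rw [hexp]
      exact hrem lam hlam J hJ

/-! ### The bounded operator on `L²`, and the theorem -/

theorem exists_continuousLinearMap_of_oscIntegral_bound (S : MvPolynomial (Fin nX ⊕ Fin nZ) ℝ)
    {a : (Fin nX → ℝ) × (Fin nZ → ℝ) → ℂ} (ha : Continuous a) (hac : HasCompactSupport a)
    (lam : ℝ) {B : ℝ} (hB : 0 ≤ B)
    (h : ∀ f : (Fin nZ → ℝ) → ℂ, MemLp f 2 →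
      eLpNorm (oscIntegral S a lam f) 2 ≤ ENNReal.ofReal B * eLpNorm f 2) :
    ∃ T : Lp ℂ 2 (volume : Measure (Fin nZ → ℝ)) →L[ℂ]
        Lp ℂ 2 (volume : Measure (Fin nX → ℝ)),
      (∀ f : Lp ℂ 2 (volume : Measure (Fin nZ → ℝ)),
        (T f : (Fin nX → ℝ) → ℂ) =ᵐ[volume] oscIntegral S a lam f) ∧ ‖T‖ ≤ B := by
  let k : (Fin nX → ℝ) × (Fin nZ → ℝ) → ℂ := fun u =>
    Complex.exp (Complex.I * (lam : ℂ) * (phaseEval S u.1 u.2 : ℂ)) * a u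
  have hk : Continuous k := by
    have := (contDiff_phaseEval S).continuous
    fun_prop
  have hkc : HasCompactSupport k := hac.mul_left
  have hmem : ∀ f : Lp ℂ 2 (volume : Measure (Fin nZ → ℝ)), MemLp (oscIntegral S a lam f) 2 :=
    fun f => ⟨aestronglyMeasurable_kernel_mul (k := k) hk (Lp.aestronglyMeasurable f),
      (h f (Lp.memLp f)).trans_lt (ENNReal.mul_lt_top ENNReal.ofReal_lt_top (Lp.memLp f).2)⟩
  have hint : ∀ (f : Lp ℂ 2 (volume : Measure (Fin nZ → ℝ))) x,
      Integrable fun z => k (x, z) * f z := fun f x =>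
    integrable_kernel_mul hk hkc (Lp.memLp f) x
  let L : Lp ℂ 2 (volume : Measure (Fin nZ → ℝ)) →ₗ[ℂ]
      Lp ℂ 2 (volume : Measure (Fin nX → ℝ)) :=
    -- The integral sees only the almost-everywhere class of `f` and converges at every `x`, so
    -- linearity holds pointwise in `x`.
    { toFun := fun f => (hmem f).toLp _
      map_add' := fun f g => by
        rw [← MemLp.toLp_add]
        congr 1
        ext x
        rw [Pi.add_apply]
        refine Eq.trans ?_ (integral_add (hint f x) (hint g x))
        refine integral_congr_ae ?_
        filter_upwards [Lp.coeFn_add f g] with z hz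
        rw [hz, Pi.add_apply, mul_add]
      map_smul' := fun c f => by
        rw [RingHom.id_apply, ← MemLp.toLp_const_smul]
        congr 1
        ext x
        rw [Pi.smul_apply, smul_eq_mul]
        refine Eq.trans ?_ (integral_const_mul c _)
        refine integral_congr_ae ?_
        filter_upwards [Lp.coeFn_smul c f] with z hz
        rw [hz, Pi.smul_apply, smul_eq_mul]
        ring }
  have hL : ∀ f, ‖L f‖ ≤ B * ‖f‖ := by
    intro f
    change ‖(hmem f).toLp _‖ ≤ _
    rw [Lp.norm_toLp, Lp.norm_def, ← ENNReal.toReal_ofReal hB, ← ENNReal.toReal_mul]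
    exact ENNReal.toReal_mono (ENNReal.mul_lt_top ENNReal.ofReal_lt_top (Lp.memLp f).2).ne
      (h f (Lp.memLp f))
  exact ⟨L.mkContinuous B hL, fun f => (hmem f).coeFn_toLp, L.mkContinuous_norm_le hB hL⟩

end Summation

theorem theorem1p1 (nX nZ m : ℕ) (hnZ : 1 ≤ nZ) (hn : nZ ≤ nX) (hm : 3 ≤ m)
    (S : MvPolynomial (Fin nX ⊕ Fin nZ) ℝ) (hS : S.IsHomogeneous m)
    (hrank : ∀ (x : Fin nX → ℝ) (z : Fin nZ → ℝ), (x, z) ≠ (0, 0) →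
      (mixedHessian S x z).rank = nZ)
    (a : (Fin nX → ℝ) × (Fin nZ → ℝ) → ℂ) (ha : ContDiff ℝ ∞ a)
    (hac : HasCompactSupport a) :
    ∃ C : ℝ, 0 < C ∧ ∀ lam : ℝ, 2 ≤ lam →
      ∃ T : Lp ℂ 2 (volume : Measure (Fin nZ → ℝ)) →L[ℂ]
          Lp ℂ 2 (volume : Measure (Fin nX → ℝ)),
        (∀ f : Lp ℂ 2 (volume : Measure (Fin nZ → ℝ)),
          (T f : (Fin nX → ℝ) → ℂ) =ᵐ[volume] oscIntegral S a lam f) ∧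
        ((m : ℝ) > ((nX : ℝ) + nZ) / nZ →
          ‖T‖ ≤ C * lam ^ (-(((nX : ℝ) + nZ) / (2 * m)))) ∧
        ((m : ℝ) = ((nX : ℝ) + nZ) / nZ →
          ‖T‖ ≤ C * lam ^ (-((nZ : ℝ) / 2)) * Real.log lam) ∧
        ((m : ℝ) < ((nX : ℝ) + nZ) / nZ →
          ‖T‖ ≤ C * lam ^ (-((nZ : ℝ) / 2))) := by
  obtain ⟨C₁, hC₁, h₁⟩ := exists_dyadic_bound hnZ hS hrank ha hac
  obtain ⟨C₂, hC₂, h₂⟩ := exists_sum_bound (nX := nX) hnZ hm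
  -- `C₁` is only nonnegative; adding one makes the constant positive.
  refine ⟨(C₁ + 1) * C₂, by positivity, fun lam hlam => ?_⟩
  obtain ⟨J, B, hJB, hgt, heq, hlt⟩ := h₂ lam hlam
  have hl : 0 < lam := by linarith
  have hB : 0 ≤ B := by rw [← hJB]; positivity
  obtain ⟨T, hT, hTn⟩ := exists_continuousLinearMap_of_oscIntegral_bound S ha.continuous hac lam
    (mul_nonneg hC₁ hB) fun f hf => hJB ▸ h₁ J lam hl f hf
  have hTB : ‖T‖ ≤ (C₁ + 1) * B := hTn.trans (by gcongr; linarith)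
  have hC : 0 ≤ C₁ + 1 := by positivity
  refine ⟨T, hT, fun h => ?_, fun h => ?_, fun h => ?_⟩
  · exact hTB.trans ((mul_le_mul_of_nonneg_left (hgt h) hC).trans_eq (by ring))
  · exact hTB.trans ((mul_le_mul_of_nonneg_left (heq h) hC).trans_eq (by ring))
  · exact hTB.trans ((mul_le_mul_of_nonneg_left (hlt h) hC).trans_eq (by ring))
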